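/- All graphs are finite, simple and undirected, and $\log$ is the natural logarithm. A box in $\mathbb{R}^d$ is a Cartesian product $I_1\times\dots\times I_d$ of non-empty intervals $I_i\subseteq\mathbb{R}$. The boxicity $\mathrm{bx}(G)$ of a graph $G$ is the minimum integer $d\ge 0$ such that $G$ is the intersection graph of boxes in $\mathbb{R}^d$, that is, such that there are boxes $(B_v)_{v\in V(G)}$ in $\mathbb{R}^d$ with $B_v\cap B_w\ne\emptyset$ if and only if $vw\in E(G)$, for all distinct $v,w\in V(G)$. Let $\mathrm{bx}(\Delta)$ be the maximum boxicity of a graph with maximum degree $\Delta$. Theorem. (a) There is a function $\varepsilon:\mathbb{N}\to\mathbb{R}$ with $\varepsilon(\Delta)\to 0$ as $\Delta\to\infty$ such that, for all sufficiently large $\Delta$, every graph $G$ with maximum degree $\Delta$ satisfies $$\mathrm{bx}(G)\le (180+\varepsilon(\Delta))\,\Delta\,\log(\Delta)\,(2e)^{\sqrt{\log\log\Delta}}\,\log\log\Delta .$$ (b) Hence $\mathrm{bx}(\Delta)=\Delta\log^{1+o(1)}\Delta$: there is a function $\delta:\mathbb{N}\to\mathbb{R}$ with $\delta(\Delta)\to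 0$ as $\Delta\to\infty$ such that $\mathrm{bx}(\Delta)=\Delta\,(\log\Delta)^{1+\delta(\Delta)}$ for all sufficiently large $\Delta$. (Remark: these bounds match the previously known lower bound $\mathrm{bx}(\Delta)=\Omega(\Delta\log\Delta)$ up to a $\log^{o(1)}\Delta$ factor.) -/

import Mathlib

open Filter Topology

/-- A `d`-dimensional box: a Cartesian product `I₁ × ⋯ × I_d` of nonempty intervals of `ℝ`
(open, closed, half-open, bounded or not). For `d = 0` the only box is the one-point space. -/
def IsBox {d : ℕ} (B : Set (Fin d → ℝ)) : Prop :=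
  ∃ I : Fin d → Set ℝ, (∀ i, (I i).OrdConnected ∧ (I i).Nonempty) ∧ B = Set.univ.pi I

/-- `G` is the intersection graph of boxes in `ℝ^d`: vertices can be assigned boxes so that
two distinct vertices are adjacent if and only if their boxes intersect. -/
def SimpleGraph.HasBoxRepresentation {V : Type*} (G : SimpleGraph V) (d : ℕ) : Prop :=
  ∃ B : V → Set (Fin d → ℝ), (∀ v, IsBox (B v)) ∧
    ∀ v w, v ≠ w → (G.Adj v w ↔ (B v ∩ B w).Nonempty)

/-- The boxicity of a graph: the least `d` such that the graph is the intersection graph of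
boxes in `ℝ^d`. For finite graphs such a `d` exists, see
`SimpleGraph.exists_hasBoxRepresentation`. -/
noncomputable def SimpleGraph.boxicity {V : Type*} (G : SimpleGraph V) : ℕ :=
  sInf {d : ℕ | G.HasBoxRepresentation d}

/-- Every finite graph is the intersection graph of boxes in some dimension. -/
theorem SimpleGraph.exists_hasBoxRepresentation {V : Type*} [Finite V] (G : SimpleGraph V) :
    ∃ d, G.HasBoxRepresentation d := by
  classical
  obtain ⟨n, ⟨e⟩⟩ := Finite.exists_equiv_fin V
  let I : V → Fin n → Set ℝ := fun v i =>
    if e v = i then Set.Icc 0 0 else if G.Adj (e.symm i) v then Set.Icc 0 1 else Set.Icc 1 1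
  refine ⟨n, fun v => Set.univ.pi (I v), fun v => ⟨I v, fun i => ?_, rfl⟩, fun v w hvw => ?_⟩
  · simp only [I]
    split_ifs
    · exact ⟨Set.ordConnected_Icc, by simp⟩
    · exact ⟨Set.ordConnected_Icc, by simp⟩
    · exact ⟨Set.ordConnected_Icc, by simp⟩
  · constructor
    · intro h
      refine ⟨fun i => if e v = i ∨ e w = i then 0 else 1, ?_, ?_⟩
      · intro i _
        by_cases h1 : e v = i
        · simp [I, h1]
        · by_cases h2 : e w = i
          · subst h2
            simp [I, h1, h.symm]
          · simp only [I, h1, h2, if_false, or_self]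
            split_ifs <;> simp
      · intro i _
        by_cases h2 : e w = i
        · simp [I, h2]
        · by_cases h1 : e v = i
          · subst h1
            simp [I, h2, h]
          · simp only [I, h1, h2, if_false, or_self]
            split_ifs <;> simp
    · rintro ⟨x, hx, hy⟩
      by_contra hn
      have h1 := hx (e v) trivial
      have h2 := hy (e v) trivial
      have hne : e w ≠ e v := fun h => hvw (e.injective h).symm
      simp [I] at h1
      simp [I, hne, hn] at h2
      have h3 : x (e v) = 0 := by simpa using h1
      have h4 : x (e v) = 1 := by simpa [hvw, Ne.symm hvw] using h2
      linarith

/-- `bx(Δ)`: the maximum boxicity of a finite graph with maximum degree `Δ`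
(with the value `0` if there were no maximum). -/
noncomputable def maxBoxicity (Δ : ℕ) : ℕ :=
  sSup {b : ℕ | ∃ (n : ℕ) (G : SimpleGraph (Fin n)) (_ : DecidableRel G.Adj),
    G.maxDegree = Δ ∧ G.boxicity = b}

/-!
**Upper bound.** A vertex set `X` with a linear order on the vertices gives an interval supergraph
of `G` which separates `x ∈ X` from every non-neighbour `v` such that `x` precedes all of
`N[v] ∩ X` (`SimpleGraph.hasBoxRepresentation_of_orders`). So it suffices to find few pairs
(set, order) such that every ordered pair of nonadjacent vertices is separated by one of them. The
sets come from two applications of the local lemma. First, the vertices are partitioned into about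
`Δ / log Δ` parts so that each vertex has at most `d = O(log Δ)` neighbours in each part. Second,
`O(log Δ)` colourings with `O(d ^ (1 + 1 / r))` colours are chosen such that for every vertex and
every part some colouring has at most `r` neighbours of the vertex in each colour class of the part.
In such a class `N[v] ∩ X` has at most `r + 1` elements, and about `2 ^ r` orders suffice,
independently of the number of vertices: a proper colouring of the square of `G` writes every
vertex as a string of `O(log Δ)` bits (with a final coordinate to make strings distinct), and
lexicographic orders twisted by a family of sign vectors that realises all patterns on `r + 1`
coordinates put `x` before `N[v] ∩ X` (`exists_signedRank_lt`). Altogether this gives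
`Δ log Δ · d ^ (1 / r) · 2 ^ r` dimensions up to powers of `log log Δ`. With `S = √(log log Δ)` and
`r ≈ (6/5) S` the last two factors are `exp ((5/6 + (6/5) log 2) S)`, and as
`5/6 + (6/5) log 2 < 1 + log 2` this is smaller than `(2e) ^ S` by a factor that absorbs all
constants and all powers of `log log Δ`. Hence the error term `ε` can be taken to be `0`.

**Lower bound.** For the second part a lower bound of order `Δ log Δ / (log log Δ) ^ 2` suffices.
A box representation in dimension `d` of a bipartite graph writes the nonadjacent pairs as the union
of `2 d` Ferrers relations, and, if the graph has no empty `s × s` rectangle, each of these is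
controlled by a list of `s` vertices on either side (`not_hasBoxRepresentation_of_uncovered`). The
lists cover a nonadjacent pair `(a, b)` only if, in one of them, the predecessors of `a` (or `b`)
all miss the other vertex. In a random bipartite graph with parts of size `n ≈ Δ log Δ` and
density about `1 / (16 log Δ)` and for fixed lists, most vertices occur rarely in the lists and have
few short prefixes, so that a pair of them is uncovered with probability at least
`Δ ^ (-1/2) / 8`; a greedy choice of vertices with disjoint blocks of predecessors
(`exists_disjoint_blocks`) makes `m ^ 2` of these events independent, where `m` is linear in `n` up
to powers of `log Δ`. This beats the number `n ^ (4 s d)` of configurations of lists. Adding a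
disjoint star makes the maximum degree exactly `Δ`.

Thus `log (bx(Δ) / Δ) = log log Δ + o(log log Δ)`, which is the second part.
-/

/-! ### Uniform probability on finite types -/

section Probability

open Classical in
/-- The probability of the event `E` under the uniform distribution on the finite type `Ω`. -/
noncomputable def unifProb {Ω : Type*} [Fintype Ω] (E : Ω → Prop) : ℝ :=
  ((Finset.univ.filter E).card : ℝ) / Fintype.card Ω

lemma DependsOn.forall_mem {ι α J : Type*} {E : J → (ι → α) → Prop} {S : J → Set ι} {T : Set ι}
    {s : Finset J} (h : ∀ j, DependsOn (E j) (S j)) (hT : ∀ j ∈ s, S j ⊆ T) :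
    DependsOn (fun ω => ∀ j ∈ s, ¬ E j ω) T := by
  intro x y hxy
  have : ∀ j ∈ s, E j x = E j y := fun j hj => h j fun i hi => hxy i (hT j hj hi)
  apply propext
  constructor
  · intro H j hj; rw [← this j hj]; exact H j hj
  · intro H j hj; rw [this j hj]; exact H j hj

variable {Ω : Type*} [Fintype Ω]

lemma unifProb_eq (E : Ω → Prop) [DecidablePred E] :
    unifProb E = ((Finset.univ.filter E).card : ℝ) / Fintype.card Ω := by
  unfold unifProb
  congr!

lemma unifProb_nonneg (E : Ω → Prop) : 0 ≤ unifProb E := by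
  unfold unifProb; positivity

lemma unifProb_mono {E F : Ω → Prop} (h : ∀ ω, E ω → F ω) : unifProb E ≤ unifProb F := by
  classical
  simp only [unifProb_eq]
  gcongr
  exact h _

lemma unifProb_congr {E F : Ω → Prop} (h : ∀ ω, E ω ↔ F ω) : unifProb E = unifProb F :=
  le_antisymm (unifProb_mono fun ω => (h ω).1) (unifProb_mono fun ω => (h ω).2)

lemma unifProb_true [Nonempty Ω] : unifProb (fun _ : Ω => True) = 1 := by
  classical
  simp only [unifProb_eq]
  have : (Fintype.card Ω : ℝ) ≠ 0 := by exact_mod_cast Fintype.card_ne_zero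
  simp [Finset.card_univ, this]

lemma unifProb_le_one (E : Ω → Prop) : unifProb E ≤ 1 := by
  classical
  simp only [unifProb_eq]
  apply div_le_one_of_le₀ _ (by positivity)
  exact_mod_cast Finset.card_le_univ _

lemma unifProb_false_of_forall {E : Ω → Prop} (h : ∀ ω, ¬ E ω) : unifProb E = 0 := by
  classical
  simp only [unifProb_eq]
  simp [Finset.filter_false_of_mem (s := Finset.univ) (p := E) (fun ω _ => h ω)]

lemma unifProb_split (E F : Ω → Prop) :
    unifProb E = unifProb (fun ω => E ω ∧ F ω) + unifProb (fun ω => E ω ∧ ¬ F ω) := by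
  classical
  simp only [unifProb_eq]
  rw [← add_div, ← Nat.cast_add]
  congr 2
  rw [← Finset.filter_filter, ← Finset.filter_filter, Finset.card_filter_add_card_filter_not]

lemma unifProb_not [Nonempty Ω] (E : Ω → Prop) : unifProb (fun ω => ¬ E ω) = 1 - unifProb E := by
  have h := unifProb_split (fun _ : Ω => True) E
  rw [unifProb_true] at h
  simp only [true_and] at h
  linarith

lemma unifProb_or_le (E F : Ω → Prop) :
    unifProb (fun ω => E ω ∨ F ω) ≤ unifProb E + unifProb F := by
  classical
  simp only [unifProb_eq]
  rw [← add_div, ← Nat.cast_add]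
  gcongr
  rw [Finset.filter_or]
  exact Finset.card_union_le _ _

lemma unifProb_exists_mem_le {J : Type*} (s : Finset J) (E : J → Ω → Prop) :
    unifProb (fun ω => ∃ j ∈ s, E j ω) ≤ ∑ j ∈ s, unifProb (E j) := by
  classical
  induction s using Finset.induction_on with
  | empty => simp [unifProb_false_of_forall]
  | insert a s ha ih =>
    rw [Finset.sum_insert ha]
    refine le_trans (unifProb_mono (F := fun ω => E a ω ∨ ∃ j ∈ s, E j ω) ?_)
      ((unifProb_or_le _ _).trans (by gcongr))
    intro ω
    simp

lemma unifProb_exists_le {J : Type*} [Fintype J] (E : J → Ω → Prop) {p : ℝ}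
    (h : ∀ j, unifProb (E j) ≤ p) :
    unifProb (fun ω => ∃ j, E j ω) ≤ Fintype.card J * p := by
  refine le_trans (unifProb_mono (F := fun ω => ∃ j ∈ (Finset.univ : Finset J), E j ω) ?_)
    ((unifProb_exists_mem_le _ _).trans ?_)
  · intro ω; simp
  · refine (Finset.sum_le_sum fun j _ => h j).trans ?_
    simp [Finset.card_univ]

lemma exists_not_of_unifProb_lt_one [Nonempty Ω] {E : Ω → Prop} (h : unifProb E < 1) :
    ∃ ω, ¬ E ω := by
  by_contra hc
  push Not at hc
  have := unifProb_congr (E := E) (F := fun _ => True) (fun ω => by simp [hc ω])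
  rw [unifProb_true] at this
  linarith

lemma unifProb_equiv {Ω' : Type*} [Fintype Ω'] (e : Ω ≃ Ω') (E : Ω' → Prop) :
    unifProb (fun ω => E (e ω)) = unifProb E := by
  classical
  simp only [unifProb_eq]
  rw [Fintype.card_congr e]
  congr 2
  apply Finset.card_bij (fun ω _ => e ω)
  · intro a; simp
  · intro a _ b _ h; exact e.injective h
  · intro b hb; exact ⟨e.symm b, by simpa using hb, by simp⟩

variable {ι α : Type*} [Fintype ι] [DecidableEq ι] [Fintype α]

/-- Coordinates of a uniformly random function are independent. -/
lemma unifProb_pi (P : ι → α → Prop) :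
    unifProb (fun ω : ι → α => ∀ i, P i (ω i)) = ∏ i, unifProb (P i) := by
  classical
  simp only [unifProb_eq]
  rw [Finset.prod_div_distrib, ← Nat.cast_prod, ← Nat.cast_prod, Fintype.card_pi,
    ← Fintype.card_piFinset]
  congr 3
  ext ω
  simp [Fintype.mem_piFinset]

/-- Events that depend on disjoint sets of coordinates are independent. -/
lemma unifProb_and_of_disjoint [Nonempty α] {E F : (ι → α) → Prop} {S T : Set ι}
    (hE : DependsOn E S) (hF : DependsOn F T) (hST : Disjoint S T) :
    unifProb (fun ω => E ω ∧ F ω) = unifProb E * unifProb F := by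
  classical
  -- Exchanging the coordinates in `S` between two points matches the pairs `(x, y)` with
  -- `E x ∧ F x` with the pairs with `E x ∧ F y`.
  have key : ((Finset.univ.filter fun ω => E ω ∧ F ω) ×ˢ (Finset.univ : Finset (ι → α))).card =
      ((Finset.univ.filter E) ×ˢ (Finset.univ.filter F)).card := by
    let f : (ι → α) × (ι → α) → (ι → α) × (ι → α) := fun z =>
      (fun i => if i ∈ S then z.1 i else z.2 i, fun i => if i ∈ S then z.2 i else z.1 i)
    have hf : ∀ z, f (f z) = z := by
      rintro ⟨x, y⟩
      simp only [f, Prod.mk.injEq]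
      constructor <;> funext i <;> by_cases hi : i ∈ S <;> simp [hi]
    have h1 : ∀ z, E (f z).1 = E z.1 := fun z => hE fun i hi => by simp [f, hi]
    have h2 : ∀ z, F (f z).2 = F z.1 := fun z => hF fun i hi => by
      simp [f, Set.disjoint_right.1 hST hi]
    refine Finset.card_bij' (fun z _ => f z) (fun z _ => f z) ?_ ?_ ?_ ?_
    · intro z hz
      simp only [Finset.mem_product, Finset.mem_filter, Finset.mem_univ, true_and, and_true] at hz ⊢
      rw [h1, h2]; exact hz
    · intro z hz
      simp only [Finset.mem_product, Finset.mem_filter, Finset.mem_univ, true_and, and_true] at hz ⊢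
      have := h2 (f z)
      rw [hf] at this
      rw [h1, ← this]; exact hz
    · intro z _; exact hf z
    · intro z _; exact hf z
  rw [Finset.card_product, Finset.card_product, Finset.card_univ] at key
  simp only [unifProb_eq]
  have hc : (Fintype.card (ι → α) : ℝ) ≠ 0 := by exact_mod_cast Fintype.card_ne_zero
  have key' : (((Finset.univ.filter fun ω => E ω ∧ F ω).card : ℝ) * Fintype.card (ι → α)) =
      ((Finset.univ.filter E).card : ℝ) * (Finset.univ.filter F).card := by exact_mod_cast key
  rw [div_mul_div_comm, ← key', mul_div_mul_right _ _ hc]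

/-- Avoiding many events with disjoint supports, each of probability at least `ρ`. -/
lemma unifProb_forall_not_le [Nonempty α] {J : Type*} (s : Finset J)
    (E : J → (ι → α) → Prop) (S : J → Set ι) (hE : ∀ j, DependsOn (E j) (S j)) {ρ : ℝ}
    (hd : ∀ j ∈ s, ∀ k ∈ s, j ≠ k → Disjoint (S j) (S k))
    (hρ : ∀ j ∈ s, ρ ≤ unifProb (E j)) (hρ1 : ρ ≤ 1) :
    unifProb (fun ω => ∀ j ∈ s, ¬ E j ω) ≤ (1 - ρ) ^ s.card := by
  classical
  induction s using Finset.induction_on with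
  | empty => simpa using unifProb_le_one _
  | insert a s ha ih =>
    have h1 : DependsOn (fun ω => ¬ E a ω) (S a) := fun x y hxy => by
      simp only [hE a hxy]
    have h2 : DependsOn (fun ω => ∀ j ∈ s, ¬ E j ω) (⋃ j ∈ s, S j) :=
      DependsOn.forall_mem hE fun j hj => Set.subset_biUnion_of_mem (u := S) hj
    have hdis : Disjoint (S a) (⋃ j ∈ s, S j) := by
      simp only [Set.disjoint_iUnion_right]
      intro j hj
      exact hd a (by simp) j (by simp [hj]) (fun h => ha (h ▸ hj))
    have := unifProb_and_of_disjoint h1 h2 hdis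
    rw [Finset.card_insert_of_notMem ha, pow_succ', unifProb_congr (F := fun ω => ¬ E a ω ∧
      ∀ j ∈ s, ¬ E j ω) (fun ω => by simp), this, unifProb_not]
    have h3 := hρ a (by simp)
    have h4 := ih (fun j hj k hk => hd j (by simp [hj]) k (by simp [hk]))
      (fun j hj => hρ j (by simp [hj]))
    apply mul_le_mul (by linarith) h4 (unifProb_nonneg _) (by linarith)

/-- The symmetric Lovász local lemma, for events determined by the coordinates of a uniformly
random function: two events are allowed to be dependent only if their supports meet. -/
theorem lovasz_local_lemma [Nonempty α] {J : Type*} [Fintype J]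
    (E : J → (ι → α) → Prop) (S : J → Set ι) (hE : ∀ j, DependsOn (E j) (S j)) (p : ℝ) (D : ℕ)
    (hp : ∀ j, unifProb (E j) ≤ p)
    (hD : ∀ j, ∃ N : Finset J, N.card ≤ D ∧ ∀ k, k ≠ j → ¬ Disjoint (S j) (S k) → k ∈ N)
    (h : 4 * p * (D + 1) ≤ 1) :
    ∃ ω : ι → α, ∀ j, ¬ E j ω := by
  classical
  rcases isEmpty_or_nonempty J with hJ | ⟨⟨j0⟩⟩
  · exact ⟨fun _ => Classical.arbitrary α, fun j => hJ.elim j⟩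
  have hp0 : 0 ≤ p := (unifProb_nonneg _).trans (hp j0)
  have hp4 : 4 * p ≤ 1 := by
    have : 0 ≤ 4 * p * D := by positivity
    linarith
  let N : Finset J → ℝ := fun T => unifProb fun ω => ∀ k ∈ T, ¬ E k ω
  have hN0 : ∀ T, 0 ≤ N T := fun T => unifProb_nonneg _
  have main : ∀ n : ℕ, ∀ T : Finset J, T.card = n → ∀ j, j ∉ T →
      unifProb (fun ω => (∀ k ∈ T, ¬ E k ω) ∧ E j ω) ≤ 2 * p * N T := by
    intro n
    induction n using Nat.strong_induction_on with
    | _ n ih =>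
      intro T hT j hj
      let T₂ := T.filter fun k => Disjoint (S j) (S k)
      let T₁ := T.filter fun k => ¬ Disjoint (S j) (S k)
      have hsplit : ∀ k, k ∈ T ↔ k ∈ T₁ ∨ k ∈ T₂ := by
        intro k; simp only [T₁, T₂, Finset.mem_filter]; tauto
      have hT₁ : (T₁.card : ℝ) ≤ D := by
        obtain ⟨M, hM, hM'⟩ := hD j
        have : T₁ ⊆ M := fun k hk => by
          simp only [T₁, Finset.mem_filter] at hk
          exact hM' k (fun h => hj (h ▸ hk.1)) hk.2
        exact_mod_cast (Finset.card_le_card this).trans hM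
      -- The event is independent of the ones with disjoint support.
      have h1 : unifProb (fun ω => (∀ k ∈ T, ¬ E k ω) ∧ E j ω) ≤ p * N T₂ := by
        have hind := unifProb_and_of_disjoint (hE j) (DependsOn.forall_mem (s := T₂) hE
          (T := ⋃ k ∈ T₂, S k) fun k hk => Set.subset_biUnion_of_mem (u := S) hk) (by
            simp only [Set.disjoint_iUnion_right]
            intro k hk
            exact (Finset.mem_filter.1 hk).2)
        refine (unifProb_mono (F := fun ω => E j ω ∧ ∀ k ∈ T₂, ¬ E k ω) ?_).trans ?_
        · intro ω hω
          exact ⟨hω.2, fun k hk => hω.1 k ((hsplit k).2 (Or.inr hk))⟩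
        · rw [hind]
          exact mul_le_mul_of_nonneg_right (hp j) (hN0 _)
      -- Few events have intersecting support, and each is unlikely by induction.
      have h2 : N T₂ ≤ N T + T₁.card * (2 * p * N T₂) := by
        rcases T₁.eq_empty_or_nonempty with he | hne
        · have : T₂ = T := by
            ext k; rw [hsplit k, he]; simp
          rw [this, he]; simp
        have hlt : T₂.card < n := by
          rw [← hT]
          apply Finset.card_lt_card
          refine ⟨Finset.filter_subset _ _, fun hs => ?_⟩
          obtain ⟨k, hk⟩ := hne
          have hk' := hs (Finset.mem_filter.1 hk).1
          exact (Finset.mem_filter.1 hk).2 (Finset.mem_filter.1 hk').2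
        have hs := unifProb_split (fun ω => ∀ k ∈ T₂, ¬ E k ω) (fun ω => ∀ k ∈ T₁, ¬ E k ω)
        have e1 : unifProb (fun ω => (∀ k ∈ T₂, ¬ E k ω) ∧ (∀ k ∈ T₁, ¬ E k ω)) = N T := by
          apply unifProb_congr
          intro ω
          constructor
          · intro hω k hk
            rcases (hsplit k).1 hk with h | h
            · exact hω.2 k h
            · exact hω.1 k h
          · intro hω
            exact ⟨fun k hk => hω k ((hsplit k).2 (Or.inr hk)),
              fun k hk => hω k ((hsplit k).2 (Or.inl hk))⟩
        have e2 : unifProb (fun ω => (∀ k ∈ T₂, ¬ E k ω) ∧ ¬ (∀ k ∈ T₁, ¬ E k ω)) ≤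
            T₁.card * (2 * p * N T₂) := by
          refine (unifProb_mono (F := fun ω => ∃ u ∈ T₁, (∀ k ∈ T₂, ¬ E k ω) ∧ E u ω) ?_).trans
            ((unifProb_exists_mem_le _ _).trans ?_)
          · rintro ω ⟨ha, hb⟩
            push Not at hb
            obtain ⟨u, hu, hu'⟩ := hb
            exact ⟨u, hu, ha, hu'⟩
          · rw [← nsmul_eq_mul]
            apply Finset.sum_le_card_nsmul
            intro u hu
            refine ih _ hlt T₂ rfl u fun hu2 => ?_
            exact (Finset.mem_filter.1 hu).2 (Finset.mem_filter.1 hu2).2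
        change N T₂ = _ at hs
        rw [e1] at hs
        linarith
      have h3 : (T₁.card : ℝ) * (2 * p * N T₂) ≤ D * (2 * p * N T₂) := by
        have := hN0 T₂
        gcongr
      have h4 : 4 * p * (D + 1) * N T₂ ≤ 1 * N T₂ := mul_le_mul_of_nonneg_right h (hN0 _)
      have h5 : 0 ≤ p * N T₂ := mul_nonneg hp0 (hN0 _)
      have h6 : N T₂ ≤ 2 * N T := by nlinarith
      calc _ ≤ p * N T₂ := h1
        _ ≤ p * (2 * N T) := by gcongr
        _ = _ := by ring
  have hpos : ∀ T : Finset J, 0 < N T := by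
    intro T
    induction T using Finset.induction_on with
    | empty =>
      have : N ∅ = 1 := by
        simp only [N]
        rw [unifProb_congr (F := fun _ => True) (fun ω => by simp), unifProb_true]
      rw [this]; norm_num
    | insert a T ha ih =>
      have hs := unifProb_split (fun ω => ∀ k ∈ T, ¬ E k ω) (fun ω => E a ω)
      have hm := main _ T rfl a ha
      have e : unifProb (fun ω => (∀ k ∈ T, ¬ E k ω) ∧ ¬ E a ω) = N (insert a T) := by
        apply unifProb_congr
        intro ω
        simp [and_comm]
      change N T = _ at hs
      rw [e] at hs
      nlinarith
  have hfin := hpos Finset.univ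
  by_contra hc
  push Not at hc
  have : N Finset.univ = 0 := unifProb_false_of_forall fun ω hω => by
    obtain ⟨j, hj⟩ := hc ω
    exact hω j (Finset.mem_univ _) hj
  linarith

lemma unifProb_eq_const [DecidableEq α] (a : α) :
    unifProb (fun x : α => x = a) = 1 / Fintype.card α := by
  classical
  simp only [unifProb_eq]
  rw [Finset.filter_eq' Finset.univ a]
  simp

/-- A random function is constant equal to `a` on a given set `S`. -/
lemma unifProb_forall_mem_eq [Nonempty α] (S : Finset ι) (a : α) :
    unifProb (fun ω : ι → α => ∀ i ∈ S, ω i = a) = (1 / (Fintype.card α : ℝ)) ^ S.card := by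
  classical
  have h := unifProb_pi (fun (i : ι) (x : α) => i ∈ S → x = a)
  rw [h, ← Finset.prod_subset (Finset.subset_univ S)]
  · rw [Finset.prod_congr rfl (g := fun _ => 1 / (Fintype.card α : ℝ)), Finset.prod_const]
    intro i hi
    rw [unifProb_congr (F := fun x => x = a) (fun x => by simp [hi]), unifProb_eq_const]
  · intro i _ hi
    rw [unifProb_congr (F := fun _ => True) (fun x => by simp [hi]), unifProb_true]

/-- Union bound for a colour class of a random colouring having more than `r` elements in `N`. -/
lemma unifProb_exists_large_class_le [Nonempty α] [DecidableEq α] (N : Finset ι) (r : ℕ) :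
    unifProb (fun c : ι → α => ∃ m, r < (N.filter fun u => c u = m).card) ≤
      Fintype.card α * (N.card.choose (r + 1) * (1 / (Fintype.card α : ℝ)) ^ (r + 1)) := by
  apply unifProb_exists_le
  intro m
  refine (unifProb_mono (F := fun c => ∃ S ∈ N.powersetCard (r + 1), ∀ i ∈ S, c i = m) ?_).trans
    ((unifProb_exists_mem_le _ _).trans ?_)
  · intro c hc
    obtain ⟨S, hS, hS'⟩ := Finset.exists_subset_card_eq (Nat.succ_le_of_lt hc)
    refine ⟨S, Finset.mem_powersetCard.2 ⟨hS.trans (Finset.filter_subset _ _), hS'⟩, ?_⟩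
    intro i hi
    exact (Finset.mem_filter.1 (hS hi)).2
  · rw [Finset.sum_congr rfl (g := fun _ => (1 / (Fintype.card α : ℝ)) ^ (r + 1))]
    · simp [Finset.card_powersetCard]
    · intro S hS
      rw [unifProb_forall_mem_eq, (Finset.mem_powersetCard.1 hS).2]

/-- Independent repetitions. -/
lemma unifProb_forall_swap {κ β : Type*} [Fintype κ] [DecidableEq κ] [Fintype β]
    (Q : (ι → β) → Prop) :
    unifProb (fun c : ι → κ → β => ∀ j, Q fun u => c u j) = unifProb Q ^ Fintype.card κ := by
  classical
  have h := unifProb_equiv (Equiv.piComm fun (_ : ι) (_ : κ) => β) (fun c => ∀ j, Q (c j))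
  have h2 := unifProb_pi (fun (_ : κ) (f : ι → β) => Q f)
  rw [Finset.prod_const, Finset.card_univ] at h2
  rw [← h2, ← h]
  rfl

/-- If every constraint is met by a proportion at least `θ` of the objects, then a few objects meet
all constraints. -/
lemma exists_covering_family {C β : Type*} [Fintype C] [Fintype β] [Nonempty β]
    (R : C → β → Prop) (θ : ℝ) (hR : ∀ c, θ ≤ unifProb (R c)) (σ : ℕ)
    (h : Fintype.card C * (1 - θ) ^ σ < 1) : ∃ f : Fin σ → β, ∀ c, ∃ i, R c (f i) := by
  classical
  have h1 : unifProb (fun f : Fin σ → β => ∃ c, ∀ i, ¬ R c (f i)) ≤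
      Fintype.card C * (1 - θ) ^ σ := by
    apply unifProb_exists_le
    intro c
    rw [unifProb_pi (fun (_ : Fin σ) x => ¬ R c x), Finset.prod_const, Finset.card_univ,
      Fintype.card_fin, unifProb_not]
    apply pow_le_pow_left₀
    · linarith [unifProb_le_one (R c)]
    · linarith [hR c]
  obtain ⟨f, hf⟩ := exists_not_of_unifProb_lt_one (h1.trans_lt h)
  push Not at hf
  exact ⟨f, hf⟩

end Probability

/-! ### Greedy colouring -/

/-- A symmetric relation in which every vertex has fewer than `N` neighbours has a proper colouring
with `N` colours. -/
lemma exists_coloring_of_degree_lt {V : Type*} [Finite V] (R : V → V → Prop)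
    (hsymm : ∀ u v, R u v → R v u) (N : ℕ)
    (hdeg : ∀ v, ∃ s : Finset V, s.card < N ∧ ∀ u, R v u → u ∈ s) :
    ∃ χ : V → Fin N, ∀ u v, u ≠ v → R u v → χ u ≠ χ v := by
  classical
  have := Fintype.ofFinite V
  rcases isEmpty_or_nonempty V with hV | ⟨⟨v0⟩⟩
  · exact ⟨fun v => hV.elim v, fun u => hV.elim u⟩
  have hN : 0 < N := by
    obtain ⟨s, hs, -⟩ := hdeg v0; omega
  have key : ∀ T : Finset V, ∃ χ : V → Fin N, ∀ u ∈ T, ∀ v ∈ T, u ≠ v → R u v → χ u ≠ χ v := by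
    intro T
    induction T using Finset.induction_on with
    | empty => exact ⟨fun _ => ⟨0, hN⟩, by simp⟩
    | insert a T ha ih =>
      obtain ⟨χ, hχ⟩ := ih
      obtain ⟨s, hs, hs'⟩ := hdeg a
      obtain ⟨m, hm⟩ : ∃ m : Fin N, m ∉ s.image χ := by
        by_contra hc
        push Not at hc
        have h1 : (Finset.univ : Finset (Fin N)) ⊆ s.image χ := fun m _ => hc m
        have h2 := (Finset.card_le_card h1).trans Finset.card_image_le
        simp at h2
        omega
      have hm' : ∀ u, R a u → χ u ≠ m := fun u hu he =>
        hm (Finset.mem_image.2 ⟨u, hs' u hu, he⟩)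
      refine ⟨Function.update χ a m, ?_⟩
      intro u hu v hv huv hR
      by_cases hua : u = a
      · subst hua
        rw [Function.update_self, Function.update_of_ne (Ne.symm huv)]
        exact (hm' v hR).symm
      · by_cases hva : v = a
        · subst hva
          rw [Function.update_self, Function.update_of_ne hua]
          exact hm' u (hsymm _ _ hR)
        · rw [Function.update_of_ne hua, Function.update_of_ne hva]
          exact hχ u (Finset.mem_of_mem_insert_of_ne hu hua) v
            (Finset.mem_of_mem_insert_of_ne hv hva) huv hR
  obtain ⟨χ, hχ⟩ := key Finset.univ
  exact ⟨χ, fun u v => hχ u (Finset.mem_univ _) v (Finset.mem_univ _)⟩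

/-! ### Box representations from vertex orders -/

/-- Each pair of a vertex set `X i` and a function `π i` on the vertices gives an interval graph
containing `G`: the vertex `v` gets the interval from the minimum of `π i` on `N[v] ∩ X i` to
`π i v` if `v ∈ X i`, and to a large constant otherwise. It separates `x ∈ X i` from `v` if `x`
precedes `N[v] ∩ X i`. -/
lemma SimpleGraph.hasBoxRepresentation_of_orders {V ι : Type*} [Finite V] [Fintype ι]
    (G : SimpleGraph V) (X : ι → Set V) (π : ι → V → ℝ)
    (h : ∀ x v, x ≠ v → ¬ G.Adj v x →
      ∃ i, x ∈ X i ∧ ∀ u ∈ X i, (u = v ∨ G.Adj v u) → π i x < π i u) :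
    G.HasBoxRepresentation (Fintype.card ι) := by
  classical
  have hM : ∀ i, ∃ M : ℝ, ∀ u, π i u < M := by
    intro i
    obtain ⟨M, hM⟩ := (Set.finite_range (π i)).bddAbove
    exact ⟨M + 1, fun u => lt_of_le_of_lt (hM ⟨u, rfl⟩) (by linarith)⟩
  choose M hM using hM
  let J : V → ι → Set ℝ := fun v i =>
    {y | (M i ≤ y ∨ ∃ u ∈ X i, (u = v ∨ G.Adj v u) ∧ π i u ≤ y) ∧ (v ∈ X i → y ≤ π i v)}
  have hord : ∀ v i, (J v i).OrdConnected := by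
    intro v i
    refine ⟨fun y₁ h₁ y₂ h₂ z hz => ⟨?_, fun hv => hz.2.trans (h₂.2 hv)⟩⟩
    rcases h₁.1 with h | ⟨u, hu, huv, huy⟩
    · exact Or.inl (h.trans hz.1)
    · exact Or.inr ⟨u, hu, huv, huy.trans hz.1⟩
  have hself : ∀ v i, v ∈ X i → π i v ∈ J v i := fun v i hv =>
    ⟨Or.inr ⟨v, hv, Or.inl rfl, le_rfl⟩, fun _ => le_rfl⟩
  have hMmem : ∀ v i, v ∉ X i → M i ∈ J v i := fun v i hv =>
    ⟨Or.inl le_rfl, fun h => absurd h hv⟩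
  have hne : ∀ v i, (J v i).Nonempty := fun v i => by
    by_cases hv : v ∈ X i
    · exact ⟨_, hself v i hv⟩
    · exact ⟨_, hMmem v i hv⟩
  have hadj1 : ∀ v w i, G.Adj v w → v ∈ X i → (w ∈ X i → π i v ≤ π i w) →
      (J v i ∩ J w i).Nonempty := fun v w i hvw hv hle =>
    ⟨π i v, hself v i hv, Or.inr ⟨v, hv, Or.inr hvw.symm, le_rfl⟩, hle⟩
  have hadj : ∀ v w i, G.Adj v w → (J v i ∩ J w i).Nonempty := by
    intro v w i hvw
    by_cases hv : v ∈ X i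
    · by_cases hw : w ∈ X i
      · rcases le_total (π i v) (π i w) with hle | hle
        · exact hadj1 v w i hvw hv fun _ => hle
        · rw [Set.inter_comm]; exact hadj1 w v i hvw.symm hw fun _ => hle
      · exact hadj1 v w i hvw hv fun h => absurd h hw
    · by_cases hw : w ∈ X i
      · rw [Set.inter_comm]; exact hadj1 w v i hvw.symm hw fun h => absurd h hv
      · exact ⟨M i, hMmem v i hv, hMmem w i hw⟩
  let e := Fintype.equivFin ι
  refine ⟨fun v => Set.univ.pi fun j => J v (e.symm j), fun v =>
    ⟨fun j => J v (e.symm j), fun j => ⟨hord _ _, hne _ _⟩, rfl⟩, fun v w hvw => ?_⟩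
  rw [← Set.pi_inter_distrib, Set.univ_pi_nonempty_iff]
  constructor
  · exact fun ha j => hadj v w _ ha
  · intro hall
    by_contra hn
    obtain ⟨i, hi, hlt⟩ := h v w hvw (fun hh => hn hh.symm)
    obtain ⟨y, hy₁, hy₂⟩ := hall (e i)
    simp only [Equiv.symm_apply_apply] at hy₁ hy₂
    have h1 := hy₁.2 hi
    rcases hy₂.1 with h2 | ⟨u, hu, huw, huy⟩
    · linarith [hM i v]
    · linarith [hlt u hu huw]

/-! ### Signed lexicographic orders -/

section Lexicographic

/-- The key of `u` with the coordinates where `ε` is false negated. -/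
def signedKey {V : Type*} {B : ℕ} (key : V → Fin B → ℤ) (ε : Fin B → Bool) (u : V) :
    Lex (Fin B → ℤ) :=
  toLex fun i => if ε i then key u i else - key u i

open Classical in
/-- The rank of `u` when vertices are sorted lexicographically by their signed keys. -/
noncomputable def signedRank {V : Type*} [Fintype V] {B : ℕ} (key : V → Fin B → ℤ)
    (ε : Fin B → Bool) (u : V) : ℝ :=
  ((Finset.univ.filter fun w => signedKey key ε w < signedKey key ε u).card : ℝ)

lemma signedRank_lt {V : Type*} [Fintype V] {B : ℕ} (key : V → Fin B → ℤ) (ε : Fin B → Bool)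
    {x u : V} (i : Fin B) (hi : ∀ j < i, key x j = key u j) (hne : key x i ≠ key u i)
    (hε : ε i = decide (key x i < key u i)) : signedRank key ε x < signedRank key ε u := by
  classical
  have hlt : signedKey key ε x < signedKey key ε u := by
    refine ⟨i, fun j hj => ?_, ?_⟩
    · simp [signedKey, hi j hj]
    · rcases lt_or_gt_of_ne hne with h | h
      · have : ε i = true := by simpa [h] using hε
        simp [signedKey, this, h]
      · have : ε i = false := by simpa [not_lt.2 h.le] using hε
        simp [signedKey, this, h]
  unfold signedRank
  norm_cast
  apply Finset.card_lt_card
  refine ⟨fun w hw => ?_, fun hs => ?_⟩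
  · simp only [Finset.mem_filter, Finset.mem_univ, true_and] at hw ⊢
    exact hw.trans hlt
  · have := hs (Finset.mem_filter.2 ⟨Finset.mem_univ x, hlt⟩)
    exact lt_irrefl _ (Finset.mem_filter.1 this).2

/-- There are `σ` sign vectors that realise all sign patterns on any `R` coordinates. -/
lemma exists_universal_signs (B R σ : ℕ)
    (h : ((2 * B : ℝ)) ^ R * (1 - (1 / 2) ^ R) ^ σ < 1) :
    ∃ f : Fin σ → Fin B → Bool, ∀ c : Fin R → Fin B × Bool,
      (∀ l l', (c l).1 = (c l').1 → (c l).2 = (c l').2) → ∃ i, ∀ l, f i (c l).1 = (c l).2 := by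
  classical
  refine (exists_covering_family (C := Fin R → Fin B × Bool) (β := Fin B → Bool)
    (fun c ε => (∀ l l', (c l).1 = (c l').1 → (c l).2 = (c l').2) →
      ∀ l, ε (c l).1 = (c l).2) ((1 / 2) ^ R) ?_ σ ?_).imp fun f hf c hc => ?_
  · intro c
    by_cases hc : ∀ l l', (c l).1 = (c l').1 → (c l).2 = (c l').2
    · have h1 := unifProb_pi (ι := Fin B) (α := Bool) fun i x => ∀ l, (c l).1 = i → x = (c l).2
      have h2 : unifProb (fun ε : Fin B → Bool => ∀ i l, (c l).1 = i → ε i = (c l).2) ≤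
          unifProb (fun ε : Fin B → Bool =>
            (∀ l l', (c l).1 = (c l').1 → (c l).2 = (c l').2) → ∀ l, ε (c l).1 = (c l).2) :=
        unifProb_mono fun ε hε _ l => hε _ l rfl
      refine le_trans ?_ h2
      rw [h1]
      let S : Finset (Fin B) := Finset.univ.image fun l => (c l).1
      have hS : S.card ≤ R := by
        simpa using Finset.card_image_le (s := (Finset.univ : Finset (Fin R)))
          (f := fun l => (c l).1)
      rw [← Finset.prod_subset (Finset.subset_univ S)]
      · rw [Finset.prod_congr rfl (g := fun _ => (1 / 2 : ℝ)), Finset.prod_const]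
        · exact pow_le_pow_of_le_one (by norm_num) (by norm_num) hS
        · intro i hi
          obtain ⟨l, -, hl⟩ := Finset.mem_image.1 hi
          rw [unifProb_congr (F := fun x => x = (c l).2), unifProb_eq_const]
          · simp
          · intro x
            constructor
            · intro hx; exact hx l hl
            · rintro rfl l' hl'
              exact hc l l' (hl.trans hl'.symm)
      · intro i _ hi
        rw [unifProb_congr (F := fun _ => True), unifProb_true]
        intro x
        simp only [iff_true]
        intro l hl
        exact absurd (Finset.mem_image.2 ⟨l, Finset.mem_univ _, hl⟩) hi
    · rw [unifProb_congr (F := fun _ => True) (fun ε => by simp [hc]), unifProb_true]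
      exact pow_le_one₀ (by norm_num) (by norm_num)
  · simpa [mul_comm] using h
  · obtain ⟨i, hi⟩ := hf c
    exact ⟨i, hi hc⟩

/-- Keys made of `b` bits (of a colour) followed by an integer. -/
def bitKey {V : Type*} {b : ℕ} (χ : V → Fin b → Bool) (e : V → ℤ) (u : V) : Fin (b + 1) → ℤ :=
  Fin.snoc (α := fun _ => ℤ) (fun i => if χ u i then 1 else 0) (e u)

/-- Orders by signed keys put any vertex before any set of `R` vertices of different colours. A
vertex `u` of that set first differs from `x` in some coordinate, and only the sign there matters.
Two vertices may impose opposite signs only in the last coordinate, where they would both have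
the colour of `x`. -/
lemma exists_signedRank_lt {V : Type*} [Fintype V] {b R σ : ℕ} (hσ : 0 < σ)
    (χ : V → Fin b → Bool) (e : V → ℤ) (he : Function.Injective e)
    (f : Fin σ → Fin (b + 1) → Bool)
    (hf : ∀ c : Fin R → Fin (b + 1) × Bool,
      (∀ l l', (c l).1 = (c l').1 → (c l).2 = (c l').2) → ∃ i, ∀ l, f i (c l).1 = (c l).2)
    (x : V) (U : Finset V) (hxU : x ∉ U) (hU : U.card ≤ R)
    (hχ : ∀ u ∈ U, ∀ v ∈ U, u ≠ v → χ u ≠ χ v) :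
    ∃ i, ∀ u ∈ U, signedRank (bitKey χ e) (f i) x < signedRank (bitKey χ e) (f i) u := by
  classical
  rcases U.eq_empty_or_nonempty with rfl | hne
  · exact ⟨⟨0, hσ⟩, by simp⟩
  have hfirst : ∀ u ∈ U, ∃ i, (∀ j < i, bitKey χ e x j = bitKey χ e u j) ∧
      bitKey χ e x i ≠ bitKey χ e u i := by
    intro u hu
    have hex : ∃ i, bitKey χ e x i ≠ bitKey χ e u i := by
      refine ⟨Fin.last b, ?_⟩
      simp only [bitKey, Fin.snoc_last]
      exact fun h => hxU (he h ▸ hu)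
    let S := Finset.univ.filter fun i => bitKey χ e x i ≠ bitKey χ e u i
    have hS : S.Nonempty := by
      obtain ⟨i, hi⟩ := hex
      exact ⟨i, by simpa [S] using hi⟩
    refine ⟨S.min' hS, fun j hj => ?_, ?_⟩
    · by_contra hc
      have := S.min'_le j (by simpa [S] using hc)
      exact absurd hj (not_lt.2 this)
    · have := S.min'_mem hS
      simpa [S] using this
  have hne' : Nonempty U := ⟨⟨hne.choose, hne.choose_spec⟩⟩
  obtain ⟨emb⟩ : Nonempty (U ↪ Fin R) :=
    Function.Embedding.nonempty_of_card_le (by simpa using hU)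
  let g : Fin R → U := Function.invFun emb
  have hg : Function.Surjective g := Function.invFun_surjective emb.injective
  choose! p hp1 hp2 using hfirst
  let c : Fin R → Fin (b + 1) × Bool := fun l =>
    (p (g l), decide (bitKey χ e x (p (g l)) < bitKey χ e (g l) (p (g l))))
  obtain ⟨i, hi⟩ := hf c (by
    intro l l' hll
    have h1 := hp2 _ (g l).2
    have h2 := hp2 _ (g l').2
    have h3 := hp1 _ (g l).2
    have h4 := hp1 _ (g l').2
    simp only [c] at hll ⊢
    rw [← hll] at h2 h4 ⊢
    revert h1 h2 h3 h4
    generalize p (g l) = q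
    refine Fin.lastCases ?_ (fun q => ?_) q
    · intro _ _ h3 h4
      have : (g l : V) = g l' := by
        by_contra hne
        refine hχ _ (g l).2 _ (g l').2 hne (funext fun j => ?_)
        have h5 := (h3 j.castSucc (Fin.castSucc_lt_last j)).symm.trans
          (h4 j.castSucc (Fin.castSucc_lt_last j))
        simp only [bitKey, Fin.snoc_castSucc] at h5
        revert h5
        cases χ (g l) j <;> cases χ (g l') j <;> simp
      rw [this]
    · intro h1 h2 _ _
      simp only [bitKey, Fin.snoc_castSucc] at h1 h2 ⊢
      revert h1 h2
      cases χ x q <;> cases χ (g l) q <;> cases χ (g l') q <;> simp)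
  refine ⟨i, fun u hu => ?_⟩
  obtain ⟨l, hl⟩ := hg ⟨u, hu⟩
  have hl' : (g l : V) = u := by rw [hl]
  have := hi l
  simp only [c, hl'] at this
  exact signedRank_lt _ _ (p u) (hp1 u hu) (hp2 u hu) this

end Lexicographic

/-! ### The upper bound in terms of parameters -/

section Upper

variable {V : Type*} [Fintype V] [DecidableEq V] (G : SimpleGraph V) [DecidableRel G.Adj]

lemma card_biUnion_neighborFinset_le {Δ : ℕ} (hdeg : ∀ v, G.degree v ≤ Δ) (v : V) :
    ((G.neighborFinset v).biUnion fun u => G.neighborFinset u).card ≤ Δ ^ 2 := by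
  refine (Finset.card_biUnion_le_card_mul _ _ Δ fun u _ => hdeg u).trans ?_
  rw [sq]
  exact Nat.mul_le_mul_right _ (hdeg v)

/-- The local lemma for a random function on the vertices, with one event for each vertex that
depends on the values on its neighbourhood. -/
lemma exists_good_function {α : Type*} [Fintype α] [Nonempty α] {Δ : ℕ}
    (hdeg : ∀ v, G.degree v ≤ Δ) (E : V → (V → α) → Prop)
    (hE : ∀ v, DependsOn (E v) (G.neighborFinset v : Set V)) (p : ℝ)
    (hp : ∀ v, unifProb (E v) ≤ p) (h : 4 * p * ((Δ : ℝ) ^ 2 + 1) ≤ 1) :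
    ∃ ω : V → α, ∀ v, ¬ E v ω := by
  refine lovasz_local_lemma E (fun v => (G.neighborFinset v : Set V)) hE p (Δ ^ 2) hp ?_
    (by push_cast; exact h)
  intro v
  refine ⟨_, card_biUnion_neighborFinset_le G hdeg v, fun w _ hw => ?_⟩
  rw [Set.not_disjoint_iff] at hw
  obtain ⟨u, hu1, hu2⟩ := hw
  simp only [Finset.mem_coe, SimpleGraph.mem_neighborFinset] at hu1 hu2
  simp only [Finset.mem_biUnion, SimpleGraph.mem_neighborFinset]
  exact ⟨u, hu1, hu2.symm⟩

/-- Partition of the vertex set in which every vertex has few neighbours in each part. -/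
lemma exists_partition {Δ : ℕ} (hdeg : ∀ v, G.degree v ≤ Δ) (k d : ℕ) (hk : 0 < k)
    (h : 4 * (k * (Δ.choose (d + 1) * (1 / (k : ℝ)) ^ (d + 1))) * ((Δ : ℝ) ^ 2 + 1) ≤ 1) :
    ∃ P : V → Fin k, ∀ v i, ((G.neighborFinset v).filter fun u => P u = i).card ≤ d := by
  have : Nonempty (Fin k) := ⟨⟨0, hk⟩⟩
  obtain ⟨P, hP⟩ := exists_good_function G hdeg
    (fun v (P : V → Fin k) => ∃ i, d < ((G.neighborFinset v).filter fun u => P u = i).card)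
    (fun v x y hxy => by
      have : ∀ i, (G.neighborFinset v).filter (fun u => x u = i) =
          (G.neighborFinset v).filter fun u => y u = i := fun i =>
        Finset.filter_congr fun u hu => by rw [hxy u hu]
      simp only [this])
    _ (fun v => (unifProb_exists_large_class_le (G.neighborFinset v) d).trans
      (mul_le_mul_of_nonneg_left (mul_le_mul_of_nonneg_right
        (Nat.cast_le.2 (Nat.choose_le_choose _ (hdeg v))) (by positivity)) (by positivity)))
    (by simpa using h)
  push Not at hP
  exact ⟨P, hP⟩

lemma choose_mul_pow_le_third {d r w : ℕ} (hr : 1 ≤ r) (hd : 1 ≤ d) (hw : d ≤ w ^ r) :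
    ((3 * d * w : ℕ) : ℝ) * (d.choose (r + 1) * (1 / ((3 * d * w : ℕ) : ℝ)) ^ (r + 1)) ≤ 1 / 3 := by
  have hw0 : 0 < w := by
    rcases Nat.eq_zero_or_pos w with rfl | h
    · rw [zero_pow (by omega)] at hw; omega
    · exact h
  have hℓ : (0 : ℝ) < ((3 * d * w : ℕ) : ℝ) := by exact_mod_cast (by positivity)
  have h1 : (d.choose (r + 1) : ℝ) ≤ (d : ℝ) ^ (r + 1) := by
    exact_mod_cast Nat.choose_le_pow d (r + 1)
  have h2 : (3 : ℝ) * (d : ℝ) ^ (r + 1) ≤ ((3 * d * w : ℕ) : ℝ) ^ r := by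
    have e : 3 * d ^ (r + 1) ≤ (3 * d * w) ^ r := by
      calc 3 * d ^ (r + 1) = 3 ^ 1 * d ^ r * d := by ring
        _ ≤ 3 ^ r * d ^ r * w ^ r := by gcongr; norm_num
        _ = _ := by ring
    exact_mod_cast e
  rw [div_pow, one_pow, mul_one_div, mul_div_assoc', div_le_iff₀ (by positivity), pow_succ]
  nlinarith [mul_le_mul_of_nonneg_left h1 hℓ.le, mul_le_mul_of_nonneg_right h2 hℓ.le]

/-- Given a partition with few neighbours in each part, there are `t` colourings such that for
every vertex and every part some colouring spreads the neighbours in that part well. -/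
lemma exists_colourings {Δ : ℕ} (hdeg : ∀ v, G.degree v ≤ Δ) {k d : ℕ} (P : V → Fin k)
    (hP : ∀ v i, ((G.neighborFinset v).filter fun u => P u = i).card ≤ d) {r w : ℕ} (t : ℕ)
    (hr : 1 ≤ r) (hd : 1 ≤ d) (hw : d ≤ w ^ r)
    (h : 4 * (k * (1 / 3 : ℝ) ^ t) * ((Δ : ℝ) ^ 2 + 1) ≤ 1) :
    ∃ c : V → Fin t → Fin (3 * d * w), ∀ v i, ∃ j, ∀ m,
      ((G.neighborFinset v).filter fun u => P u = i ∧ c u j = m).card ≤ r := by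
  have hw0 : 0 < w := by
    rcases Nat.eq_zero_or_pos w with rfl | h
    · rw [zero_pow (by omega)] at hw; omega
    · exact h
  have hℓ : 0 < 3 * d * w := by positivity
  have : Nonempty (Fin (3 * d * w)) := ⟨⟨0, hℓ⟩⟩
  obtain ⟨c, hc⟩ := exists_good_function G hdeg
    (fun v (c : V → Fin t → Fin (3 * d * w)) => ∃ i, ∀ j, ∃ m,
      r < (((G.neighborFinset v).filter fun u => P u = i).filter fun u => c u j = m).card)
    (fun v x y hxy => by
      have : ∀ i j m, (((G.neighborFinset v).filter fun u => P u = i).filter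
          fun u => x u j = m) = (((G.neighborFinset v).filter fun u => P u = i).filter
          fun u => y u j = m) := fun i j m =>
        Finset.filter_congr fun u hu => by rw [hxy u (Finset.mem_filter.1 hu).1]
      simp only [this])
    (k * (1 / 3 : ℝ) ^ t) (fun v => by
      have h1 := unifProb_exists_le (J := Fin k) (p := (1 / 3 : ℝ) ^ t)
        (fun i (c : V → Fin t → Fin (3 * d * w)) => ∀ j, ∃ m,
          r < (((G.neighborFinset v).filter fun u => P u = i).filter fun u => c u j = m).card) ?_
      · simpa using h1
      intro i
      rw [unifProb_forall_swap (κ := Fin t) (β := Fin (3 * d * w)) fun c => ∃ m, r <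
        (((G.neighborFinset v).filter fun u => P u = i).filter fun u => c u = m).card,
        Fintype.card_fin]
      refine pow_le_pow_left₀ (unifProb_nonneg _) ?_ _
      refine (unifProb_exists_large_class_le _ r).trans ?_
      refine le_trans ?_ (choose_mul_pow_le_third hr hd hw)
      rw [Fintype.card_fin]
      gcongr
      exact hP v i) h
  push Not at hc
  refine ⟨c, fun v i => ?_⟩
  obtain ⟨j, hj⟩ := hc v i
  refine ⟨j, fun m => ?_⟩
  rw [← Finset.filter_filter]
  exact hj m

/-- Colouring of the square of the graph by bit strings: closed neighbourhoods are rainbow. -/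
lemma exists_bit_colouring {Δ b : ℕ} (hdeg : ∀ v, G.degree v ≤ Δ)
    (hb : (Δ + 1) ^ 2 + 1 ≤ 2 ^ b) :
    ∃ χ : V → Fin b → Bool, ∀ v u u', u ≠ u' → (u = v ∨ G.Adj v u) → (u' = v ∨ G.Adj v u') →
      χ u ≠ χ u' := by
  let N : V → Finset V := fun v => insert v (G.neighborFinset v)
  have hN : ∀ v, (N v).card ≤ Δ + 1 := fun v =>
    (Finset.card_insert_le _ _).trans (Nat.succ_le_succ (hdeg v))
  have hmem : ∀ v u, u ∈ N v ↔ (u = v ∨ G.Adj v u) := by simp [N]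
  obtain ⟨χ, hχ⟩ := exists_coloring_of_degree_lt (fun u u' => ∃ v, u ∈ N v ∧ u' ∈ N v)
    (fun u u' ⟨v, h1, h2⟩ => ⟨v, h2, h1⟩) ((Δ + 1) ^ 2 + 1) (fun u => by
      refine ⟨(N u).biUnion N, ?_, ?_⟩
      · refine Nat.lt_succ_of_le ((Finset.card_biUnion_le_card_mul _ _ (Δ + 1) fun u _ =>
          hN u).trans ?_)
        rw [sq]
        exact Nat.mul_le_mul_right _ (hN u)
      · rintro u' ⟨v, h1, h2⟩
        refine Finset.mem_biUnion.2 ⟨v, ?_, h2⟩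
        rw [hmem] at h1 ⊢
        rcases h1 with rfl | h1
        · exact Or.inl rfl
        · exact Or.inr h1.symm)
  obtain ⟨emb⟩ : Nonempty (Fin ((Δ + 1) ^ 2 + 1) ↪ (Fin b → Bool)) :=
    Function.Embedding.nonempty_of_card_le (by simpa using hb)
  exact ⟨fun u => emb (χ u), fun v u u' hne h1 h2 h3 =>
    hχ u u' hne ⟨v, (hmem v u).2 h1, (hmem v u').2 h2⟩ (emb.injective h3)⟩

/-- The parameters are: `k` parts with at most `d` neighbours of a vertex in each, `t` colourings of
which one leaves at most `r` neighbours of a vertex in each class of a given part, `b` bits for a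
colour of the square of the graph, and `σ` sign vectors. -/
theorem SimpleGraph.hasBoxRepresentation_of_parameters {Δ : ℕ} (hdeg : ∀ v, G.degree v ≤ Δ)
    {k d t r w b σ : ℕ} (hk : 0 < k) (hr : 1 ≤ r) (hd : 1 ≤ d) (hw : d ≤ w ^ r)
    (hpart : 4 * (k * (Δ.choose (d + 1) * (1 / (k : ℝ)) ^ (d + 1))) * ((Δ : ℝ) ^ 2 + 1) ≤ 1)
    (hcol : 4 * (k * (1 / 3 : ℝ) ^ t) * ((Δ : ℝ) ^ 2 + 1) ≤ 1)
    (hb : (Δ + 1) ^ 2 + 1 ≤ 2 ^ b)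
    (hσ : (2 * (b + 1) : ℝ) ^ (r + 1) * (1 - (1 / 2) ^ (r + 1)) ^ σ < 1) :
    G.HasBoxRepresentation (k * (t * (3 * d * w * σ))) := by
  obtain ⟨P, hP⟩ := exists_partition G hdeg k d hk hpart
  obtain ⟨c, hc⟩ := exists_colourings G hdeg P hP t hr hd hw hcol
  obtain ⟨χ, hχ⟩ := exists_bit_colouring G hdeg hb
  obtain ⟨f, hf⟩ := exists_universal_signs (b + 1) (r + 1) σ (by push_cast; exact hσ)
  have hσ0 : 0 < σ := by
    rcases Nat.eq_zero_or_pos σ with rfl | h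
    · rw [pow_zero, mul_one] at hσ
      have : (1 : ℝ) ≤ (2 * (b + 1) : ℝ) ^ (r + 1) := one_le_pow₀ (by
        have : (0 : ℝ) ≤ b := Nat.cast_nonneg b
        linarith)
      linarith
    · exact h
  let e : V → ℤ := fun v => (Fintype.equivFin V v : ℕ)
  have he : Function.Injective e := fun u v huv => by
    simpa [e, Fin.val_inj] using huv
  have key := G.hasBoxRepresentation_of_orders
    (ι := Fin k × Fin t × Fin (3 * d * w) × Fin σ)
    (fun i => {u | P u = i.1 ∧ c u i.2.1 = i.2.2.1})
    (fun i => signedRank (bitKey χ e) (f i.2.2.2)) ?_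
  · simpa using key
  intro x v hxv hnadj
  obtain ⟨j, hj⟩ := hc v (P x)
  let U : Finset V := Finset.univ.filter fun u =>
    (P u = P x ∧ c u j = c x j) ∧ (u = v ∨ G.Adj v u)
  have hUcard : U.card ≤ r + 1 := by
    have : U ⊆ insert v ((G.neighborFinset v).filter fun u => P u = P x ∧ c u j = c x j) := by
      intro u hu
      simp only [U, Finset.mem_filter, Finset.mem_univ, true_and] at hu
      simp only [Finset.mem_insert, Finset.mem_filter, SimpleGraph.mem_neighborFinset]
      tauto
    exact (Finset.card_le_card this).trans ((Finset.card_insert_le _ _).trans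
      (Nat.succ_le_succ (hj _)))
  obtain ⟨i, hi⟩ := exists_signedRank_lt hσ0 χ e he f hf x U
    (by simp [U, hxv, hnadj]) hUcard (fun u hu u' hu' hne => by
      simp only [U, Finset.mem_filter, Finset.mem_univ, true_and] at hu hu'
      exact hχ v u u' hne hu.2 hu'.2)
  refine ⟨(P x, j, c x j, i), ⟨rfl, rfl⟩, fun u hu huv => hi u ?_⟩
  simp only [U, Finset.mem_filter, Finset.mem_univ, true_and]
  exact ⟨hu, huv⟩

end Upper

/-! ### Disjoint blocks for a family of lists -/

section Blocks

variable {A K : Type*} [DecidableEq A] [Fintype K] {s : ℕ}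

/-- The positions at which `a` occurs in the lists `α`. -/
def listPositions (α : K → Fin s → A) (a : A) : Finset (K × Fin s) :=
  Finset.univ.filter fun z => α z.1 z.2 = a

/-- An element is rare if it occurs at most `s` times in the lists `α`. -/
def IsRare (α : K → Fin s → A) (a : A) : Prop := (listPositions α a).card ≤ s

instance (α : K → Fin s → A) : DecidablePred (IsRare α) := fun _ => Nat.decLe _ _

/-- The rare elements that precede the position `z` in its list. -/
def rarePrefix (α : K → Fin s → A) (z : K × Fin s) : Finset A :=
  (Finset.univ.filter fun i => i < z.2 ∧ IsRare α (α z.1 i)).image (α z.1)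

/-- All rare elements that precede `a` in one of the lists. -/
def rareBlock (α : K → Fin s → A) (a : A) : Finset A :=
  (listPositions α a).biUnion (rarePrefix α)

variable {α : K → Fin s → A}

lemma mem_listPositions {a : A} {z : K × Fin s} : z ∈ listPositions α a ↔ α z.1 z.2 = a := by
  simp [listPositions]

lemma mem_rarePrefix {x : A} {z : K × Fin s} :
    x ∈ rarePrefix α z ↔ ∃ i < z.2, α z.1 i = x ∧ IsRare α x := by
  simp only [rarePrefix, Finset.mem_image, Finset.mem_filter, Finset.mem_univ, true_and]
  constructor
  · rintro ⟨i, ⟨h1, h2⟩, rfl⟩; exact ⟨i, h1, rfl, h2⟩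
  · rintro ⟨i, h1, rfl, h2⟩; exact ⟨i, ⟨h1, h2⟩, rfl⟩

lemma card_rarePrefix_le (z : K × Fin s) : (rarePrefix α z).card ≤ s :=
  Finset.card_image_le.trans (by simpa using Finset.card_le_univ (α := Fin s) _)

lemma mem_rareBlock {x a : A} :
    x ∈ rareBlock α a ↔ ∃ j i i', i < i' ∧ α j i' = a ∧ α j i = x ∧ IsRare α x := by
  simp only [rareBlock, Finset.mem_biUnion, mem_listPositions, mem_rarePrefix, Prod.exists]
  constructor
  · rintro ⟨j, i', h1, i, h2, h3, h4⟩; exact ⟨j, i, i', h2, h1, h3, h4⟩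
  · rintro ⟨j, i, i', h2, h1, h3, h4⟩; exact ⟨j, i', h1, i, h2, h3, h4⟩

lemma card_rareBlock_le {a : A} (ha : IsRare α a) : (rareBlock α a).card ≤ s * s :=
  (Finset.card_biUnion_le_card_mul _ _ s fun z _ => card_rarePrefix_le z).trans
    (Nat.mul_le_mul_right _ ha)

lemma card_filter_mem_rareBlock_le [Fintype A] {x : A} (hx : IsRare α x) :
    (Finset.univ.filter fun a => x ∈ rareBlock α a).card ≤ s * s := by
  have : (Finset.univ.filter fun a => x ∈ rareBlock α a) ⊆
      (listPositions α x ×ˢ (Finset.univ : Finset (Fin s))).image fun y => α y.1.1 y.2 := by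
    intro a ha
    obtain ⟨j, i, i', -, h2, h3, -⟩ := mem_rareBlock.1 (Finset.mem_filter.1 ha).2
    simp only [Finset.mem_image, Finset.mem_product, mem_listPositions, Finset.mem_univ, and_true,
      Prod.exists]
    exact ⟨j, i, i', h3, h2⟩
  refine (Finset.card_le_card this).trans (Finset.card_image_le.trans ?_)
  rw [Finset.card_product, Finset.card_univ, Fintype.card_fin]
  exact Nat.mul_le_mul_right _ hx

/-- Along a list the sizes of the rare prefixes increase at rare elements, so few rare elements
have short prefixes. -/
lemma card_short_rarePrefix_le (hα : ∀ j, Function.Injective (α j)) (q : ℕ) :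
    (Finset.univ.filter fun z : K × Fin s =>
      IsRare α (α z.1 z.2) ∧ (rarePrefix α z).card < q).card ≤ Fintype.card K * q := by
  have hlt : ∀ j i i', i < i' → IsRare α (α j i) →
      (rarePrefix α (j, i)).card < (rarePrefix α (j, i')).card := by
    intro j i i' hii hr
    apply Finset.card_lt_card
    refine ⟨fun x hx => ?_, fun hs => ?_⟩
    · obtain ⟨l, hl, h1, h2⟩ := mem_rarePrefix.1 hx
      exact mem_rarePrefix.2 ⟨l, hl.trans hii, h1, h2⟩
    · obtain ⟨l, hl, h1, h2⟩ := mem_rarePrefix.1 (hs (mem_rarePrefix.2 ⟨i, hii, rfl, hr⟩))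
      exact hl.ne (hα j h1)
  rw [← Finset.card_range q, ← Finset.card_univ, ← Finset.card_product]
  refine Finset.card_le_card_of_injOn (fun z => (z.1, (rarePrefix α z).card)) ?_ ?_
  · intro z hz
    have hz' := (Finset.mem_filter.1 hz).2
    simpa using hz'.2
  · rintro ⟨j, i⟩ hz ⟨j', i'⟩ hz' heq
    have hz := (Finset.mem_filter.1 hz).2
    have hz' := (Finset.mem_filter.1 hz').2
    simp only [Prod.mk.injEq] at heq ⊢
    obtain ⟨rfl, heq⟩ := heq
    refine ⟨rfl, ?_⟩
    rcases lt_trichotomy i i' with h | h | h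
    · exact absurd heq (hlt j i i' h hz.1).ne
    · exact h
    · exact absurd heq (hlt j i' i h hz'.1).ne'

/-- An element is typical if it is rare, is never the first rare element of a list and has a short
rare prefix (of fewer than `q` elements) at most `τ` times. -/
def IsTypical (α : K → Fin s → A) (q τ : ℕ) (a : A) : Prop :=
  IsRare α a ∧ (∀ z ∈ listPositions α a, (rarePrefix α z).Nonempty) ∧
    ((listPositions α a).filter fun z => (rarePrefix α z).card < q).card ≤ τ

lemma card_le_two_mul_card_typical [Fintype A] [DecidablePred (IsTypical (K := K) (s := s) α q τ)]
    (hα : ∀ j, Function.Injective (α j))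
    (h : 2 * Fintype.card K * (2 * (τ + 1) + q) ≤ Fintype.card A * (τ + 1)) :
    Fintype.card A ≤ 2 * (Finset.univ.filter (IsTypical α q τ)).card := by
  classical
  set κ := Fintype.card K
  let bad₁ : Finset A := Finset.univ.filter fun a => ¬ IsRare α a
  let bad₂ : Finset A := (Finset.univ.filter fun z : K × Fin s =>
    IsRare α (α z.1 z.2) ∧ (rarePrefix α z).card < 1).image fun z => α z.1 z.2
  let bad₃ : Finset A := Finset.univ.filter fun a => IsRare α a ∧
    τ + 1 ≤ ((listPositions α a).filter fun z => (rarePrefix α z).card < q).card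
  have hdisj : ∀ a b : A, a ≠ b → Disjoint (listPositions α a) (listPositions α b) := by
    intro a b hab
    rw [Finset.disjoint_left]
    intro z h1 h2
    exact hab ((mem_listPositions.1 h1).symm.trans (mem_listPositions.1 h2))
  have hb₁ : bad₁.card ≤ κ := by
    have h1 : bad₁.card * (s + 1) ≤ κ * s := by
      calc bad₁.card * (s + 1) ≤ ∑ a ∈ bad₁, (listPositions α a).card := by
            rw [← smul_eq_mul]
            apply Finset.card_nsmul_le_sum
            intro a ha
            exact Nat.succ_le_of_lt (not_le.1 (Finset.mem_filter.1 ha).2)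
        _ = (bad₁.biUnion (listPositions α)).card :=
            (Finset.card_biUnion fun a _ b _ hab => hdisj a b hab).symm
        _ ≤ Fintype.card (K × Fin s) := Finset.card_le_univ _
        _ = κ * s := by simp [κ]
    nlinarith
  have hb₂ : bad₂.card ≤ κ := by
    refine Finset.card_image_le.trans ((card_short_rarePrefix_le hα 1).trans ?_)
    simp [κ]
  have hb₃ : bad₃.card * (τ + 1) ≤ κ * q := by
    calc bad₃.card * (τ + 1) ≤ ∑ a ∈ bad₃,
          ((listPositions α a).filter fun z => (rarePrefix α z).card < q).card := by
          rw [← smul_eq_mul]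
          apply Finset.card_nsmul_le_sum
          intro a ha
          exact (Finset.mem_filter.1 ha).2.2
      _ = (bad₃.biUnion fun a =>
          (listPositions α a).filter fun z => (rarePrefix α z).card < q).card :=
          (Finset.card_biUnion fun a _ b _ hab => Finset.disjoint_of_subset_left
            (Finset.filter_subset _ _) (Finset.disjoint_of_subset_right
            (Finset.filter_subset _ _) (hdisj a b hab))).symm
      _ ≤ _ := Finset.card_le_card ?_
      _ ≤ κ * q := card_short_rarePrefix_le hα q
    intro z hz
    obtain ⟨a, ha, hz⟩ := Finset.mem_biUnion.1 hz
    obtain ⟨h1, h2⟩ := Finset.mem_filter.1 hz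
    refine Finset.mem_filter.2 ⟨Finset.mem_univ _, ?_, h2⟩
    rw [mem_listPositions.1 h1]
    exact (Finset.mem_filter.1 ha).2.1
  have hcover : (Finset.univ : Finset A) ⊆
      Finset.univ.filter (IsTypical α q τ) ∪ (bad₁ ∪ bad₂ ∪ bad₃) := by
    intro a _
    simp only [Finset.mem_union]
    by_cases h1 : IsRare α a
    · by_cases h2 : ∀ z ∈ listPositions α a, (rarePrefix α z).Nonempty
      · by_cases h3 : ((listPositions α a).filter fun z => (rarePrefix α z).card < q).card ≤ τ
        · exact Or.inl (Finset.mem_filter.2 ⟨Finset.mem_univ _, h1, h2, h3⟩)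
        · exact Or.inr (Or.inr (Finset.mem_filter.2 ⟨Finset.mem_univ _, h1, by omega⟩))
      · push Not at h2
        obtain ⟨z, hz, hz'⟩ := h2
        refine Or.inr (Or.inl (Or.inr (Finset.mem_image.2 ⟨z, Finset.mem_filter.2
          ⟨Finset.mem_univ _, ?_, ?_⟩, mem_listPositions.1 hz⟩)))
        · rw [mem_listPositions.1 hz]; exact h1
        · simp [hz']
    · exact Or.inr (Or.inl (Or.inl (Finset.mem_filter.2 ⟨Finset.mem_univ _, h1⟩)))
  have hle := (Finset.card_le_card hcover).trans (Finset.card_union_le _ _)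
  have hle2 := Finset.card_union_le (bad₁ ∪ bad₂) bad₃
  have hle3 := Finset.card_union_le bad₁ bad₂
  rw [Finset.card_univ] at hle
  set T := (Finset.univ.filter (IsTypical α q τ)).card
  have h5 : Fintype.card A ≤ T + (2 * κ + bad₃.card) := by omega
  have h6 : Fintype.card A * (τ + 1) ≤ T * (τ + 1) + (2 * κ * (τ + 1) + κ * q) := by
    calc _ ≤ (T + (2 * κ + bad₃.card)) * (τ + 1) := Nat.mul_le_mul_right _ h5
      _ = T * (τ + 1) + (2 * κ * (τ + 1) + bad₃.card * (τ + 1)) := by ring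
      _ ≤ _ := by gcongr
  have h7 : Fintype.card A * (τ + 1) ≤ (2 * T) * (τ + 1) := by nlinarith
  exact Nat.le_of_mul_le_mul_right h7 (by omega)

/-- Many typical elements have pairwise disjoint blocks that avoid all of these elements. The sets
`T a` and `L a` describe a way to meet every prefix of `a`: contain the set `T a`, and meet the
few large sets of `L a`. -/
lemma exists_disjoint_blocks [Fintype A] (hs : 0 < s) (hα : ∀ j, Function.Injective (α j)) (q τ : ℕ)
    (h : 2 * Fintype.card K * (2 * (τ + 1) + q) ≤ Fintype.card A * (τ + 1)) :
    ∃ (A₁ : Finset A) (D T : A → Finset A) (L : A → Finset (Finset A)),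
      Fintype.card A ≤ 8 * s ^ 4 * A₁.card ∧
      (∀ a ∈ A₁, ∀ a' ∈ A₁, a ≠ a' → Disjoint (D a) (D a')) ∧
      (∀ a ∈ A₁, ∀ a' ∈ A₁, a ∉ D a') ∧
      (∀ a ∈ A₁, T a ⊆ D a ∧ (T a).card ≤ τ ∧ (L a).card ≤ s ∧
        ∀ P ∈ L a, P ⊆ D a ∧ q ≤ P.card) ∧
      (∀ a ∈ A₁, ∀ N : Set A, (∀ x ∈ T a, x ∈ N) → (∀ P ∈ L a, ∃ x ∈ P, x ∈ N) →
        ∀ j i, α j i = a → ∃ i' < i, α j i' ∈ N) := by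
  classical
  let typ := Finset.univ.filter (IsTypical α q τ)
  have htyp : Fintype.card A ≤ 2 * typ.card := card_le_two_mul_card_typical hα h
  let C : A → A → Prop := fun a a' =>
    ¬ Disjoint (rareBlock α a) (rareBlock α a') ∨ a ∈ rareBlock α a' ∨ a' ∈ rareBlock α a
  obtain ⟨χ, hχ⟩ := exists_coloring_of_degree_lt
    (fun a a' => a ∈ typ ∧ a' ∈ typ ∧ C a a')
    (fun a a' ⟨h1, h2, h3⟩ => ⟨h2, h1, by
      rcases h3 with h | h | h
      · exact Or.inl fun h' => h h'.symm
      · exact Or.inr (Or.inr h)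
      · exact Or.inr (Or.inl h)⟩) (4 * s ^ 4) (fun a => by
      by_cases hr : IsRare α a
      swap
      · refine ⟨∅, by simpa using by positivity, fun a' ha' => ?_⟩
        exact absurd (Finset.mem_filter.1 ha'.1).2.1 hr
      refine ⟨((rareBlock α a).biUnion fun x => Finset.univ.filter fun a' => x ∈ rareBlock α a') ∪
        ((Finset.univ.filter fun a' => a ∈ rareBlock α a') ∪ rareBlock α a), ?_, ?_⟩
      · have h1 : ((rareBlock α a).biUnion fun x =>
            Finset.univ.filter fun a' => x ∈ rareBlock α a').card ≤ (s * s) * (s * s) := by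
          refine (Finset.card_biUnion_le_card_mul _ _ (s * s) fun x hx => ?_).trans
            (Nat.mul_le_mul_right _ (card_rareBlock_le hr))
          obtain ⟨-, -, -, -, -, -, hx⟩ := mem_rareBlock.1 hx
          exact card_filter_mem_rareBlock_le hx
        have h2 := card_filter_mem_rareBlock_le hr
        have h3 := card_rareBlock_le hr
        refine lt_of_le_of_lt ((Finset.card_union_le _ _).trans
          (add_le_add h1 ((Finset.card_union_le _ _).trans (add_le_add h2 h3)))) ?_
        have h4 : 1 ≤ s * s := Nat.mul_pos hs hs
        have : s ^ 4 = (s * s) * (s * s) := by ring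
        rw [this]
        nlinarith
      · rintro a' ⟨-, -, hC⟩
        simp only [Finset.mem_union, Finset.mem_biUnion, Finset.mem_filter, Finset.mem_univ,
          true_and]
        rcases hC with h | h | h
        · obtain ⟨x, hx, hx'⟩ := Finset.not_disjoint_iff.1 h
          exact Or.inl ⟨x, hx, hx'⟩
        · exact Or.inr (Or.inl h)
        · exact Or.inr (Or.inr h))
  -- The largest colour class has the required properties.
  obtain ⟨m, hm⟩ : ∃ m, typ.card ≤ 4 * s ^ 4 * (typ.filter fun a => χ a = m).card := by
    have hpos : 0 < 4 * s ^ 4 := by positivity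
    by_contra hc
    push Not at hc
    have h1 := Finset.card_eq_sum_card_fiberwise (f := χ) (s := typ) (t := Finset.univ)
      (fun a _ => by simp)
    have h2 : 4 * s ^ 4 * typ.card < ∑ _m : Fin (4 * s ^ 4), typ.card := by
      conv_lhs => rw [h1, Finset.mul_sum]
      exact Finset.sum_lt_sum_of_nonempty ⟨⟨0, hpos⟩, Finset.mem_univ _⟩ fun m _ => hc m
    simp at h2
  have hcls : ∀ a, a ∈ typ.filter (fun a => χ a = m) → IsTypical α q τ a ∧ χ a = m := by
    intro a ha
    obtain ⟨h1, h2⟩ := Finset.mem_filter.1 ha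
    exact ⟨(Finset.mem_filter.1 h1).2, h2⟩
  have hno : ∀ a ∈ typ.filter (fun a => χ a = m), ∀ a' ∈ typ.filter (fun a => χ a = m),
      a ≠ a' → ¬ C a a' := by
    intro a ha a' ha' hne hC
    exact hχ a a' hne ⟨(Finset.mem_filter.1 ha).1, (Finset.mem_filter.1 ha').1, hC⟩
      ((hcls a ha).2.trans (hcls a' ha').2.symm)
  let T : A → Finset A := fun a =>
    ((listPositions α a).filter fun z => (rarePrefix α z).card < q).image fun z =>
      if hz : (rarePrefix α z).Nonempty then hz.choose else a
  let L : A → Finset (Finset A) := fun a =>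
    ((listPositions α a).filter fun z => ¬ (rarePrefix α z).card < q).image (rarePrefix α)
  refine ⟨typ.filter fun a => χ a = m, rareBlock α, T, L, by nlinarith, ?_, ?_, ?_, ?_⟩
  · intro a ha a' ha' hne
    have := hno a ha a' ha' hne
    simp only [C] at this
    tauto
  · intro a ha a' ha'
    by_cases hne : a = a'
    · subst hne
      intro hmem
      obtain ⟨j, i, i', hii, h1, h2, -⟩ := mem_rareBlock.1 hmem
      exact hii.ne (hα j (h2.trans h1.symm))
    · have := hno a ha a' ha' hne
      simp only [C] at this
      tauto
  · intro a ha
    obtain ⟨h1, h2, h3⟩ := (hcls a ha).1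
    refine ⟨?_, Finset.card_image_le.trans h3, Finset.card_image_le.trans
      ((Finset.card_filter_le _ _).trans h1), ?_⟩
    · intro x hx
      obtain ⟨z, hz, rfl⟩ := Finset.mem_image.1 hx
      have hz' := (Finset.mem_filter.1 hz).1
      rw [dif_pos (h2 z hz')]
      exact Finset.mem_biUnion.2 ⟨z, hz', (h2 z hz').choose_spec⟩
    · intro P hP
      obtain ⟨z, hz, rfl⟩ := Finset.mem_image.1 hP
      obtain ⟨hz1, hz2⟩ := Finset.mem_filter.1 hz
      exact ⟨fun x hx => Finset.mem_biUnion.2 ⟨z, hz1, hx⟩, not_lt.1 hz2⟩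
  · intro a ha N hT hL j i hji
    have hz : (j, i) ∈ listPositions α a := mem_listPositions.2 hji
    obtain ⟨x, hx, hxN⟩ : ∃ x ∈ rarePrefix α (j, i), x ∈ N := by
      by_cases hq : (rarePrefix α (j, i)).card < q
      · have hne := (hcls a ha).1.2.1 _ hz
        refine ⟨hne.choose, hne.choose_spec, hT _ (Finset.mem_image.2
          ⟨(j, i), Finset.mem_filter.2 ⟨hz, hq⟩, by rw [dif_pos hne]⟩)⟩
      · exact hL _ (Finset.mem_image.2 ⟨(j, i), Finset.mem_filter.2 ⟨hz, hq⟩, rfl⟩)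
    obtain ⟨i', hi', rfl, -⟩ := mem_rarePrefix.1 hx
    exact ⟨i', hi', hxN⟩

end Blocks

/-! ### Random bipartite graphs and lists -/

section RandomBipartite

lemma unifProb_forall_mem {ι α : Type*} [Fintype ι] [DecidableEq ι] [Fintype α] [Nonempty α]
    (S : Finset ι) (Q : α → Prop) :
    unifProb (fun ω : ι → α => ∀ i ∈ S, Q (ω i)) = unifProb Q ^ S.card := by
  classical
  have h := unifProb_pi (fun (i : ι) (x : α) => i ∈ S → Q x)
  rw [h, ← Finset.prod_subset (Finset.subset_univ S)]
  · rw [Finset.prod_congr rfl (g := fun _ => unifProb Q), Finset.prod_const]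
    intro i hi
    exact unifProb_congr (fun x => by simp [hi])
  · intro i _ hi
    rw [unifProb_congr (F := fun _ => True) (fun x => by simp [hi]), unifProb_true]

lemma dependsOn_forall_mem {ι α : Type*} (S : Finset ι) (Q : α → Prop) :
    DependsOn (fun ω : ι → α => ∀ i ∈ S, Q (ω i)) (S : Set ι) := by
  intro x y hxy
  apply propext
  constructor
  · intro h i hi; rw [← hxy i hi]; exact h i hi
  · intro h i hi; rw [hxy i hi]; exact h i hi

variable {M : ℕ} [NeZero M]

lemma unifProb_ne_zero : unifProb (fun x : Fin M => x ≠ 0) = 1 - 1 / (M : ℝ) := by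
  rw [unifProb_not, unifProb_eq_const, Fintype.card_fin]

/-- A random set contains the small set `T` and meets the few large sets of `L`. -/
def HitsAll {ι : Type*} (T : Finset ι) (L : Finset (Finset ι)) (ω : ι → Fin M) : Prop :=
  (∀ i ∈ T, ω i = 0) ∧ ∀ P ∈ L, ∃ i ∈ P, ω i = 0

lemma dependsOn_hitsAll {ι : Type*} {T : Finset ι} {L : Finset (Finset ι)} {D : Finset ι}
    (hT : T ⊆ D) (hL : ∀ P ∈ L, P ⊆ D) :
    DependsOn (HitsAll (M := M) T L) (D : Set ι) := by
  intro x y hxy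
  have h1 : ∀ i ∈ T, (x i = 0 ↔ y i = 0) := fun i hi => by rw [hxy i (hT hi)]
  have h2 : ∀ P ∈ L, ((∃ i ∈ P, x i = 0) ↔ ∃ i ∈ P, y i = 0) := fun P hP =>
    exists_congr fun i => and_congr_right fun hi => by rw [hxy i (hL P hP hi)]
  exact propext (and_congr (forall₂_congr h1) (forall₂_congr h2))

lemma le_unifProb_hitsAll {ι : Type*} [Fintype ι] [DecidableEq ι] {T : Finset ι}
    {L : Finset (Finset ι)} {τ s q : ℕ} (hT : T.card ≤ τ) (hL : L.card ≤ s)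
    (hP : ∀ P ∈ L, q ≤ P.card) (h : (s : ℝ) * (1 - 1 / (M : ℝ)) ^ q ≤ 1 / 2) :
    (1 / (M : ℝ)) ^ τ / 2 ≤ unifProb (HitsAll (M := M) T L) := by
  have hM1 : 1 / (M : ℝ) ≤ 1 := by
    rw [div_le_one (by exact_mod_cast Nat.pos_of_ne_zero (NeZero.ne M))]
    exact_mod_cast Nat.one_le_iff_ne_zero.2 (NeZero.ne M)
  have hM0 : 0 ≤ 1 / (M : ℝ) := by positivity
  have hTp : unifProb (fun ω : ι → Fin M => ∀ i ∈ T, ω i = 0) = (1 / (M : ℝ)) ^ T.card := by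
    rw [unifProb_forall_mem_eq, Fintype.card_fin]
  have hsplit := unifProb_split (fun ω : ι → Fin M => ∀ i ∈ T, ω i = 0)
    (fun ω => ∀ P ∈ L, ∃ i ∈ P, ω i = 0)
  have hbad : unifProb (fun ω : ι → Fin M => (∀ i ∈ T, ω i = 0) ∧
      ¬ ∀ P ∈ L, ∃ i ∈ P, ω i = 0) ≤ (1 / (M : ℝ)) ^ T.card / 2 := by
    refine (unifProb_mono (F := fun ω : ι → Fin M => ∃ P ∈ L,
      (∀ i ∈ T, ω i = 0) ∧ ∀ i ∈ P, ω i ≠ 0) ?_).trans ((unifProb_exists_mem_le _ _).trans ?_)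
    · rintro ω ⟨h1, h2⟩
      push Not at h2
      obtain ⟨P, hP, h2⟩ := h2
      exact ⟨P, hP, h1, h2⟩
    have hone : ∀ P ∈ L, unifProb (fun ω : ι → Fin M => (∀ i ∈ T, ω i = 0) ∧ ∀ i ∈ P, ω i ≠ 0) ≤
        (1 / (M : ℝ)) ^ T.card * (1 - 1 / (M : ℝ)) ^ q := by
      intro P hPL
      by_cases hd : Disjoint T P
      · rw [unifProb_and_of_disjoint (dependsOn_forall_mem T fun x => x = 0)
          (dependsOn_forall_mem P fun x => x ≠ 0) (by exact_mod_cast hd), hTp,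
          unifProb_forall_mem P (fun x : Fin M => x ≠ 0), unifProb_ne_zero]
        gcongr ?_ * ?_
        exact pow_le_pow_of_le_one (by linarith) (by linarith) (hP P hPL)
      · obtain ⟨i, hi1, hi2⟩ := Finset.not_disjoint_iff.1 hd
        rw [unifProb_false_of_forall fun ω hω => hω.2 i hi2 (hω.1 i hi1)]
        have : 0 ≤ 1 - 1 / (M : ℝ) := by linarith
        positivity
    refine (Finset.sum_le_card_nsmul _ _ _ hone).trans ?_
    rw [nsmul_eq_mul]
    have h0 : 0 ≤ (1 - 1 / (M : ℝ)) ^ q := pow_nonneg (by linarith) _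
    calc (L.card : ℝ) * ((1 / (M : ℝ)) ^ T.card * (1 - 1 / (M : ℝ)) ^ q)
        = (1 / (M : ℝ)) ^ T.card * (L.card * (1 - 1 / (M : ℝ)) ^ q) := by ring
      _ ≤ (1 / (M : ℝ)) ^ T.card * (s * (1 - 1 / (M : ℝ)) ^ q) := by gcongr
      _ ≤ (1 / (M : ℝ)) ^ T.card * (1 / 2) := by gcongr
      _ = _ := by ring
  have hpow : (1 / (M : ℝ)) ^ τ ≤ (1 / (M : ℝ)) ^ T.card := pow_le_pow_of_le_one hM0 hM1 hT
  rw [hTp] at hsplit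
  change _ ≤ unifProb (fun ω : ι → Fin M => (∀ i ∈ T, ω i = 0) ∧ ∀ P ∈ L, ∃ i ∈ P, ω i = 0)
  linarith

variable {A B K : Type*} [Fintype A] [Fintype B] [DecidableEq A] [DecidableEq B]
  [Fintype K] {s : ℕ}

/-- The nonadjacent pairs of the bipartite graph `{(a, b) | ω (a, b) = 0}` are covered by the lists
`α` and `β`: for every such pair `(a, b)` some list in `α` contains `a` and, up to `a`, has no
neighbour of `b`, or some list in `β` contains `b` and, up to `b`, has no neighbour of `a`. -/
def IsCoveredBy (α : K → Fin s → A) (β : K → Fin s → B) (ω : A × B → Fin M) : Prop :=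
  ∀ a b, ω (a, b) ≠ 0 → (∃ j i, α j i = a ∧ ∀ i' ≤ i, ω (α j i', b) ≠ 0) ∨
    (∃ j i, β j i = b ∧ ∀ i' ≤ i, ω (a, β j i') ≠ 0)

/-- For fixed lists, a random bipartite graph is covered with tiny probability: disjoint blocks
give many independent events, each of which makes some pair uncovered. -/
lemma unifProb_isCoveredBy_le (hM : 2 ≤ M) (hs : 0 < s) {n q τ m : ℕ} (hA : Fintype.card A = n)
    (hB : Fintype.card B = n) (α : K → Fin s → A) (β : K → Fin s → B)
    (hα : ∀ j, Function.Injective (α j)) (hβ : ∀ j, Function.Injective (β j))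
    (h : 2 * Fintype.card K * (2 * (τ + 1) + q) ≤ n * (τ + 1))
    (hq : (s : ℝ) * (1 - 1 / (M : ℝ)) ^ q ≤ 1 / 2) (hm : 8 * s ^ 4 * m ≤ n) :
    unifProb (IsCoveredBy (M := M) α β) ≤ (1 - (1 / (M : ℝ)) ^ (2 * τ) / 8) ^ (m * m) := by
  obtain ⟨A₁, D, T, L, hA1, hA2, hA3, hA4, hA5⟩ :=
    exists_disjoint_blocks hs hα q τ (by rw [hA]; exact h)
  obtain ⟨B₁, D', T', L', hB1, hB2, hB3, hB4, hB5⟩ :=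
    exists_disjoint_blocks hs hβ q τ (by rw [hB]; exact h)
  have hMR : (2 : ℝ) ≤ M := by exact_mod_cast hM
  have hM1 : 1 / (M : ℝ) ≤ 1 / 2 := one_div_le_one_div_of_le (by norm_num) hMR
  have hM0 : 0 ≤ 1 / (M : ℝ) := by positivity
  let fb : B → A ↪ A × B := fun b => ⟨fun x => (x, b), fun x y hxy => by simpa using hxy⟩
  let fa : A → B ↪ A × B := fun a => ⟨fun x => (a, x), fun x y hxy => by simpa using hxy⟩
  let S₀ : A × B → Finset (A × B) := fun z => {z}
  let S₁ : A × B → Finset (A × B) := fun z => (D z.1).map (fb z.2)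
  let S₂ : A × B → Finset (A × B) := fun z => (D' z.2).map (fa z.1)
  have hS₁ : ∀ x y z, (x, y) ∈ S₁ z ↔ x ∈ D z.1 ∧ z.2 = y := by
    intro x y z
    constructor
    · intro hm
      obtain ⟨a, ha, h⟩ := Finset.mem_map.1 hm
      have h : (a, z.2) = (x, y) := h
      simp only [Prod.mk.injEq] at h
      exact ⟨h.1 ▸ ha, h.2⟩
    · rintro ⟨h1, rfl⟩
      exact Finset.mem_map_of_mem (fb z.2) h1
  have hS₂ : ∀ x y z, (x, y) ∈ S₂ z ↔ y ∈ D' z.2 ∧ z.1 = x := by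
    intro x y z
    constructor
    · intro hm
      obtain ⟨a, ha, h⟩ := Finset.mem_map.1 hm
      have h : (z.1, a) = (x, y) := h
      simp only [Prod.mk.injEq] at h
      exact ⟨h.2 ▸ ha, h.1⟩
    · rintro ⟨h1, rfl⟩
      exact Finset.mem_map_of_mem (fa z.1) h1
  let E₁ : A × B → (A × B → Fin M) → Prop := fun z =>
    HitsAll ((T z.1).map (fb z.2)) ((L z.1).image fun P => P.map (fb z.2))
  let E₂ : A × B → (A × B → Fin M) → Prop := fun z =>
    HitsAll ((T' z.2).map (fa z.1)) ((L' z.2).image fun P => P.map (fa z.1))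
  -- To have well-behaved supports for all pairs, the events are made trivial elsewhere.
  let U : A × B → (A × B → Fin M) → Prop := fun z ω =>
    z ∈ A₁ ×ˢ B₁ ∧ ω z ≠ 0 ∧ E₁ z ω ∧ E₂ z ω
  let S : A × B → Set (A × B) := fun z => ↑(S₀ z ∪ (S₁ z ∪ S₂ z))
  have hd0 : ∀ z, DependsOn (fun ω : A × B → Fin M => ω z ≠ 0) (S₀ z : Set (A × B)) := by
    intro z x y hxy
    have := hxy z (by simp [S₀])
    simp only [this]
  have hd1 : ∀ z ∈ A₁ ×ˢ B₁, DependsOn (E₁ z) (S₁ z : Set (A × B)) := by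
    intro z hz
    obtain ⟨hz1, hz2⟩ := Finset.mem_product.1 hz
    refine dependsOn_hitsAll (Finset.map_subset_map.2 (hA4 _ hz1).1) ?_
    intro P hP
    obtain ⟨Q, hQ, rfl⟩ := Finset.mem_image.1 hP
    exact Finset.map_subset_map.2 ((hA4 _ hz1).2.2.2 Q hQ).1
  have hd2 : ∀ z ∈ A₁ ×ˢ B₁, DependsOn (E₂ z) (S₂ z : Set (A × B)) := by
    intro z hz
    obtain ⟨hz1, hz2⟩ := Finset.mem_product.1 hz
    refine dependsOn_hitsAll (Finset.map_subset_map.2 (hB4 _ hz2).1) ?_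
    intro P hP
    obtain ⟨Q, hQ, rfl⟩ := Finset.mem_image.1 hP
    exact Finset.map_subset_map.2 ((hB4 _ hz2).2.2.2 Q hQ).1
  have hd12 : ∀ z ∈ A₁ ×ˢ B₁, DependsOn (fun ω => E₁ z ω ∧ E₂ z ω)
      ((S₁ z ∪ S₂ z : Finset (A × B)) : Set (A × B)) := by
    intro z hz x y hxy
    have h1 := hd1 z hz (x := x) (y := y) fun i hi => hxy i (by
      simp only [Finset.coe_union]; exact Or.inl hi)
    have h2 := hd2 z hz (x := x) (y := y) fun i hi => hxy i (by
      simp only [Finset.coe_union]; exact Or.inr hi)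
    simp only [h1, h2]
  have hdU : ∀ z, DependsOn (U z) (S z) := by
    intro z x y hxy
    by_cases hz : z ∈ A₁ ×ˢ B₁
    · have h0 := hd0 z (x := x) (y := y) fun i hi => hxy i (by
        simp only [S, Finset.coe_union]; exact Or.inl hi)
      have h12 := hd12 z hz (x := x) (y := y) fun i hi => hxy i (by
        simp only [S, Finset.coe_union] at hi ⊢; exact Or.inr hi)
      simp only [U, hz, true_and]
      exact congrArg₂ And h0 h12
    · simp only [U, hz, false_and]
  have hprob : ∀ z ∈ A₁ ×ˢ B₁, (1 / (M : ℝ)) ^ (2 * τ) / 8 ≤ unifProb (U z) := by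
    intro z hz
    obtain ⟨hz1, hz2⟩ := Finset.mem_product.1 hz
    have p0 : unifProb (fun ω : A × B → Fin M => ω z ≠ 0) = 1 - 1 / (M : ℝ) := by
      have := unifProb_forall_mem (ι := A × B) (S₀ z) (fun x : Fin M => x ≠ 0)
      simpa [S₀, unifProb_ne_zero] using this
    have p1 : (1 / (M : ℝ)) ^ τ / 2 ≤ unifProb (E₁ z) := by
      obtain ⟨-, h2, h3, h4⟩ := hA4 _ hz1
      refine le_unifProb_hitsAll (by simpa using h2) (Finset.card_image_le.trans h3) ?_ hq
      intro P hP
      obtain ⟨Q, hQ, rfl⟩ := Finset.mem_image.1 hP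
      simpa using (h4 Q hQ).2
    have p2 : (1 / (M : ℝ)) ^ τ / 2 ≤ unifProb (E₂ z) := by
      obtain ⟨-, h2, h3, h4⟩ := hB4 _ hz2
      refine le_unifProb_hitsAll (by simpa using h2) (Finset.card_image_le.trans h3) ?_ hq
      intro P hP
      obtain ⟨Q, hQ, rfl⟩ := Finset.mem_image.1 hP
      simpa using (h4 Q hQ).2
    have dis12 : Disjoint (S₁ z : Set (A × B)) (S₂ z) := by
      rw [Set.disjoint_left]
      rintro ⟨x, y⟩ h1 h2
      have h1 := (hS₁ x y z).1 h1
      have h2 := (hS₂ x y z).1 h2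
      exact hA3 _ hz1 _ hz1 (h2.2 ▸ h1.1)
    have dis0 : Disjoint (S₀ z : Set (A × B)) ((S₁ z ∪ S₂ z : Finset (A × B)) : Set (A × B)) := by
      rw [Set.disjoint_left]
      rintro ⟨x, y⟩ h1 h2
      have h1 : (x, y) = z := by simpa [S₀] using h1
      subst h1
      rcases Finset.mem_union.1 h2 with h2 | h2
      · exact hA3 _ hz1 _ hz1 ((hS₁ x y _).1 h2).1
      · exact hB3 _ hz2 _ hz2 ((hS₂ x y _).1 h2).1
    have e : unifProb (U z) = (1 - 1 / (M : ℝ)) * (unifProb (E₁ z) * unifProb (E₂ z)) := by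
      rw [← unifProb_and_of_disjoint (hd1 z hz) (hd2 z hz) dis12, ← p0,
        ← unifProb_and_of_disjoint (hd0 z) (hd12 z hz) dis0]
      exact unifProb_congr fun ω => by simp only [U, hz, true_and]
    rw [e]
    have hpos : 0 ≤ (1 / (M : ℝ)) ^ τ / 2 := by positivity
    calc (1 / (M : ℝ)) ^ (2 * τ) / 8
        = (1 / 2) * ((1 / (M : ℝ)) ^ τ / 2 * ((1 / (M : ℝ)) ^ τ / 2)) := by
          rw [two_mul, pow_add]; ring
      _ ≤ _ := by
          apply mul_le_mul (by linarith) (mul_le_mul p1 p2 hpos (unifProb_nonneg _))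
            (by positivity) (by linarith)
  have hdisj : ∀ z ∈ A₁ ×ˢ B₁, ∀ z' ∈ A₁ ×ˢ B₁, z ≠ z' → Disjoint (S z) (S z') := by
    rintro ⟨a, b⟩ hz ⟨a', b'⟩ hz' hne
    obtain ⟨ha, hb⟩ := Finset.mem_product.1 hz
    obtain ⟨ha', hb'⟩ := Finset.mem_product.1 hz'
    simp only at ha hb ha' hb'
    rw [Set.disjoint_left]
    rintro ⟨x, y⟩ h1 h2
    simp only [S, S₀, Finset.mem_coe, Finset.mem_union, Finset.mem_singleton, hS₁, hS₂,
      Prod.mk.injEq] at h1 h2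
    rcases h1 with ⟨rfl, rfl⟩ | ⟨h1, rfl⟩ | ⟨h1, rfl⟩ <;>
    rcases h2 with ⟨rfl, rfl⟩ | ⟨h2, rfl⟩ | ⟨h2, rfl⟩
    · exact hne rfl
    · exact hA3 _ ha _ ha' h2
    · exact hB3 _ hb _ hb' h2
    · exact hA3 _ ha' _ ha h1
    · have hne' : a ≠ a' := fun h => hne (by rw [h])
      exact Finset.disjoint_left.1 (hA2 _ ha _ ha' hne') h1 h2
    · exact hA3 _ ha' _ ha h1
    · exact hB3 _ hb' _ hb h1
    · exact hB3 _ hb' _ hb h1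
    · have hne' : b ≠ b' := fun h => hne (by rw [h])
      exact Finset.disjoint_left.1 (hB2 _ hb _ hb' hne') h1 h2
  have hρ1 : (1 / (M : ℝ)) ^ (2 * τ) / 8 ≤ 1 := by
    have := pow_le_one₀ (n := 2 * τ) hM0 (by linarith)
    linarith
  have hρ0 : 0 ≤ (1 / (M : ℝ)) ^ (2 * τ) / 8 := by positivity
  have hmA : m ≤ A₁.card := by
    have : 8 * s ^ 4 * m ≤ 8 * s ^ 4 * A₁.card := by omega
    exact Nat.le_of_mul_le_mul_left this (by positivity)
  have hmB : m ≤ B₁.card := by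
    have : 8 * s ^ 4 * m ≤ 8 * s ^ 4 * B₁.card := by omega
    exact Nat.le_of_mul_le_mul_left this (by positivity)
  calc unifProb (IsCoveredBy (M := M) α β)
      ≤ unifProb (fun ω => ∀ z ∈ A₁ ×ˢ B₁, ¬ U z ω) := ?_
    _ ≤ (1 - (1 / (M : ℝ)) ^ (2 * τ) / 8) ^ (A₁ ×ˢ B₁).card :=
        unifProb_forall_not_le _ U S hdU hdisj hprob hρ1
    _ ≤ _ := by
        apply pow_le_pow_of_le_one (by linarith) (by linarith)
        rw [Finset.card_product]
        exact Nat.mul_le_mul hmA hmB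
  apply unifProb_mono
  rintro ω hcov ⟨a, b⟩ hz ⟨-, hne, h1, h2⟩
  obtain ⟨ha, hb⟩ := Finset.mem_product.1 hz
  rcases hcov a b hne with ⟨j, i, hji, hall⟩ | ⟨j, i, hji, hall⟩
  · obtain ⟨i', hi', h0⟩ := hA5 a ha {x | ω (x, b) = 0}
      (fun x hx => h1.1 (x, b) (Finset.mem_map_of_mem (fb b) hx))
      (fun P hP => by
        obtain ⟨y, hy, hy0⟩ := h1.2 (P.map (fb b)) (Finset.mem_image.2 ⟨P, hP, rfl⟩)
        obtain ⟨x, hx, rfl⟩ := Finset.mem_map.1 hy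
        exact ⟨x, hx, hy0⟩) j i hji
    exact hall i' hi'.le h0
  · obtain ⟨i', hi', h0⟩ := hB5 b hb {x | ω (a, x) = 0}
      (fun x hx => h2.1 (a, x) (Finset.mem_map_of_mem (fa a) hx))
      (fun P hP => by
        obtain ⟨y, hy, hy0⟩ := h2.2 (P.map (fa a)) (Finset.mem_image.2 ⟨P, hP, rfl⟩)
        obtain ⟨x, hx, rfl⟩ := Finset.mem_map.1 hy
        exact ⟨x, hx, hy0⟩) j i hji
    exact hall i' hi'.le h0

/-- A bipartite graph of bounded degree, without large empty rectangles, that no lists cover. -/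
lemma exists_uncovered_bipartite (hM : 2 ≤ M) (hs : 0 < s) {n q τ m Δ : ℕ}
    (hA : Fintype.card A = n) (hB : Fintype.card B = n)
    (h : 2 * Fintype.card K * (2 * (τ + 1) + q) ≤ n * (τ + 1))
    (hq : (s : ℝ) * (1 - 1 / (M : ℝ)) ^ q ≤ 1 / 2) (hm : 8 * s ^ 4 * m ≤ n)
    (hdeg : (n : ℝ) * (M * (n.choose (Δ + 1) * (1 / (M : ℝ)) ^ (Δ + 1))) < 1 / 4)
    (hrect : (n : ℝ) ^ (2 * s) * (1 - 1 / (M : ℝ)) ^ (s * s) < 1 / 4)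
    (hcov : (n : ℝ) ^ (2 * s * Fintype.card K) *
      (1 - (1 / (M : ℝ)) ^ (2 * τ) / 8) ^ (m * m) < 1 / 4) :
    ∃ ω : A × B → Fin M,
      (∀ a, (Finset.univ.filter fun b => ω (a, b) = 0).card ≤ Δ) ∧
      (∀ b, (Finset.univ.filter fun a => ω (a, b) = 0).card ≤ Δ) ∧
      (∀ (f : Fin s → A) (g : Fin s → B), Function.Injective f → Function.Injective g →
        ∃ i l, ω (f i, g l) = 0) ∧
      (∀ (α : K → Fin s → A) (β : K → Fin s → B), (∀ j, Function.Injective (α j)) →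
        (∀ j, Function.Injective (β j)) → ¬ IsCoveredBy α β ω) := by
  classical
  have hMR : (2 : ℝ) ≤ M := by exact_mod_cast hM
  have hM1 : 1 / (M : ℝ) ≤ 1 / 2 := one_div_le_one_div_of_le (by norm_num) hMR
  have hM0 : 0 ≤ 1 / (M : ℝ) := by positivity
  have hdegA : unifProb (fun ω : A × B → Fin M => ∃ a,
      Δ < (Finset.univ.filter fun b => ω (a, b) = 0).card) < 1 / 4 := by
    refine lt_of_le_of_lt (unifProb_exists_le _ fun a => ?_) (by rw [hA]; exact hdeg)
    have := unifProb_exists_large_class_le (ι := A × B) (α := Fin M)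
      ((Finset.univ : Finset B).map ⟨fun b => (a, b), fun x y hxy => by simpa using hxy⟩) Δ
    rw [Finset.card_map, Finset.card_univ, hB, Fintype.card_fin] at this
    refine (unifProb_mono fun ω hω => ⟨0, hω.trans_le ?_⟩).trans this
    rw [Finset.filter_map, Finset.card_map]
    rfl
  have hdegB : unifProb (fun ω : A × B → Fin M => ∃ b,
      Δ < (Finset.univ.filter fun a => ω (a, b) = 0).card) < 1 / 4 := by
    refine lt_of_le_of_lt (unifProb_exists_le _ fun b => ?_) (by rw [hB]; exact hdeg)
    have := unifProb_exists_large_class_le (ι := A × B) (α := Fin M)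
      ((Finset.univ : Finset A).map ⟨fun a => (a, b), fun x y hxy => by simpa using hxy⟩) Δ
    rw [Finset.card_map, Finset.card_univ, hA, Fintype.card_fin] at this
    refine (unifProb_mono fun ω hω => ⟨0, hω.trans_le ?_⟩).trans this
    rw [Finset.filter_map, Finset.card_map]
    rfl
  have hR : unifProb (fun ω : A × B → Fin M => ∃ fg : (Fin s → A) × (Fin s → B),
      Function.Injective fg.1 ∧ Function.Injective fg.2 ∧ ∀ i l, ω (fg.1 i, fg.2 l) ≠ 0) <
      1 / 4 := by
    refine lt_of_le_of_lt (unifProb_exists_le (p := (1 - 1 / (M : ℝ)) ^ (s * s)) _ ?_) ?_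
    · rintro ⟨f, g⟩
      by_cases hfg : Function.Injective f ∧ Function.Injective g
      · have := unifProb_forall_mem (ι := A × B)
          ((Finset.univ : Finset (Fin s × Fin s)).map
            ⟨fun z => (f z.1, g z.2), hfg.1.prodMap hfg.2⟩) (fun x : Fin M => x ≠ 0)
        rw [unifProb_ne_zero, Finset.card_map, Finset.card_univ, Fintype.card_prod,
          Fintype.card_fin] at this
        rw [← this]
        refine unifProb_mono fun ω hω z hz => ?_
        obtain ⟨⟨i, l⟩, -, rfl⟩ := Finset.mem_map.1 hz
        exact hω.2.2 i l
      · rw [unifProb_false_of_forall fun ω hω => hfg ⟨hω.1, hω.2.1⟩]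
        exact pow_nonneg (by linarith) _
    · refine lt_of_eq_of_lt ?_ hrect
      simp only [Fintype.card_prod, Fintype.card_pi, Finset.prod_const, Finset.card_univ,
        Fintype.card_fin, hA, hB]
      push_cast
      ring
  have hC : unifProb (fun ω : A × B → Fin M => ∃ αβ : (K → Fin s → A) × (K → Fin s → B),
      (∀ j, Function.Injective (αβ.1 j)) ∧ (∀ j, Function.Injective (αβ.2 j)) ∧
        IsCoveredBy αβ.1 αβ.2 ω) < 1 / 4 := by
    refine lt_of_le_of_lt (unifProb_exists_le
      (p := (1 - (1 / (M : ℝ)) ^ (2 * τ) / 8) ^ (m * m)) _ ?_) ?_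
    · rintro ⟨α, β⟩
      by_cases hαβ : (∀ j, Function.Injective (α j)) ∧ ∀ j, Function.Injective (β j)
      · exact (unifProb_mono fun ω hω => hω.2.2).trans
          (unifProb_isCoveredBy_le hM hs hA hB α β hαβ.1 hαβ.2 h hq hm)
      · rw [unifProb_false_of_forall fun ω hω => hαβ ⟨hω.1, hω.2.1⟩]
        have := pow_le_one₀ (n := 2 * τ) hM0 (by linarith)
        exact pow_nonneg (by linarith) _
    · refine lt_of_eq_of_lt ?_ hcov
      simp only [Fintype.card_prod, Fintype.card_pi, Finset.prod_const, Finset.card_univ,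
        Fintype.card_fin, hA, hB]
      push_cast
      ring
  have hall : unifProb (fun ω : A × B → Fin M =>
      ((∃ a, Δ < (Finset.univ.filter fun b => ω (a, b) = 0).card) ∨
        ∃ b, Δ < (Finset.univ.filter fun a => ω (a, b) = 0).card) ∨
      ((∃ fg : (Fin s → A) × (Fin s → B),
        Function.Injective fg.1 ∧ Function.Injective fg.2 ∧ ∀ i l, ω (fg.1 i, fg.2 l) ≠ 0) ∨
      ∃ αβ : (K → Fin s → A) × (K → Fin s → B),
      (∀ j, Function.Injective (αβ.1 j)) ∧ (∀ j, Function.Injective (αβ.2 j)) ∧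
        IsCoveredBy αβ.1 αβ.2 ω)) < 1 := by
    refine lt_of_le_of_lt ((unifProb_or_le _ _).trans
      (add_le_add (unifProb_or_le _ _) (unifProb_or_le _ _))) ?_
    linarith
  have : Nonempty (A × B → Fin M) := ⟨fun _ => 0⟩
  obtain ⟨ω, hω⟩ := exists_not_of_unifProb_lt_one hall
  push Not at hω
  obtain ⟨⟨h1, h2⟩, h3, h4⟩ := hω
  exact ⟨ω, h1, h2, fun f g hf hg => h3 (f, g) hf hg, fun α β hα hβ => h4 (α, β) hα hβ⟩

end RandomBipartite

/-! ### From boxes to lists -/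

section Ferrers

/-- A relation between two sets is a Ferrers relation if the rows are nested. -/
def IsFerrers {A B : Type*} (P : A → B → Prop) : Prop :=
  ∀ a a' b b', P a b → P a' b' → P a b' ∨ P a' b

lemma IsFerrers.swap {A B : Type*} {P : A → B → Prop} (h : IsFerrers P) :
    IsFerrers fun b a => P a b := fun b b' a a' h1 h2 => (h a a' b b' h1 h2).symm

/-- Disjoint boxes are separated in some coordinate, in one of two directions, and each coordinate
with a direction gives a Ferrers relation. -/
lemma SimpleGraph.HasBoxRepresentation.exists_ferrers {V A B : Type*} {G : SimpleGraph V} {d d' : ℕ}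
    (h : G.HasBoxRepresentation d) (hd : d ≤ d') (φ : A → V) (ψ : B → V)
    (hne : ∀ a b, φ a ≠ ψ b) :
    ∃ P : Fin d' × Bool → A → B → Prop, (∀ j, IsFerrers (P j)) ∧
      ∀ a b, ¬ G.Adj (φ a) (ψ b) ↔ ∃ j, P j a b := by
  obtain ⟨Bx, hbox, hadj⟩ := h
  choose I hI hBx using hbox
  let lt : Set ℝ → Set ℝ → Prop := fun X Y => ∀ x ∈ X, ∀ y ∈ Y, x < y
  refine ⟨fun j a b => ∃ hj : (j.1 : ℕ) < d, if j.2 then lt (I (φ a) ⟨j.1, hj⟩) (I (ψ b) ⟨j.1, hj⟩)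
    else lt (I (ψ b) ⟨j.1, hj⟩) (I (φ a) ⟨j.1, hj⟩), ?_, ?_⟩
  · have key : ∀ X X' Y Y' : Set ℝ, lt X Y → lt X' Y' → lt X Y' ∨ lt X' Y := by
      intro X X' Y Y' h1 h2
      by_contra hc
      simp only [lt] at hc
      push Not at hc
      obtain ⟨⟨x, hx, y', hy', hxy⟩, ⟨x', hx', y, hy, hxy'⟩⟩ := hc
      linarith [h1 x hx y hy, h2 x' hx' y' hy']
    rintro ⟨j, ε⟩ a a' b b' ⟨hj, h1⟩ ⟨_, h2⟩
    cases ε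
    · simp only [Bool.false_eq_true, if_false] at h1 h2 ⊢
      rcases key _ _ _ _ h1 h2 with h | h
      · exact Or.inr ⟨hj, h⟩
      · exact Or.inl ⟨hj, h⟩
    · simp only [if_true] at h1 h2 ⊢
      rcases key _ _ _ _ h1 h2 with h | h
      · exact Or.inl ⟨hj, h⟩
      · exact Or.inr ⟨hj, h⟩
  · intro a b
    rw [hadj _ _ (hne a b), hBx, hBx, ← Set.pi_inter_distrib, Set.univ_pi_nonempty_iff]
    push Not
    constructor
    · rintro ⟨i, hi⟩
      by_cases hlt : lt (I (φ a) i) (I (ψ b) i)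
      · exact ⟨(⟨i, i.2.trans_le hd⟩, true), i.2, by simpa using hlt⟩
      · refine ⟨(⟨i, i.2.trans_le hd⟩, false), i.2, ?_⟩
        simp only [lt] at hlt
        push Not at hlt
        obtain ⟨x, hx, y, hy, hyx⟩ := hlt
        simp only [Bool.false_eq_true, if_false]
        -- Disjoint intervals with `y ≤ x` for one pair of points are ordered that way throughout.
        intro y' hy' x' hx'
        by_contra hc
        push Not at hc
        have hmem : ∀ z, z ∈ I (φ a) i → z ∉ I (ψ b) i := fun z h1 h2 => by
          have : z ∈ I (φ a) i ∩ I (ψ b) i := ⟨h1, h2⟩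
          rw [hi] at this
          exact this
        have oa := (hI (φ a) i).1
        have ob := (hI (ψ b) i).1
        rcases le_total x' y with h1 | h1
        · exact hmem y (oa.out hx' hx ⟨h1, hyx⟩) hy
        · exact hmem x' hx' (ob.out hy hy' ⟨h1, hc⟩)
    · rintro ⟨⟨j, ε⟩, hj, h⟩
      refine ⟨⟨j, hj⟩, ?_⟩
      rw [Set.eq_empty_iff_forall_notMem]
      rintro z ⟨hz1, hz2⟩
      cases ε
      · simp only [Bool.false_eq_true, if_false] at h
        exact lt_irrefl _ (h z hz2 z hz1)
      · simp only [if_true] at h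
        exact lt_irrefl _ (h z hz1 z hz2)

/-- The first `s` elements when sorting by rows. -/
lemma IsFerrers.exists_list {n s : ℕ} {B : Type*} [Finite B] {P : Fin n → B → Prop}
    (h : IsFerrers P) (hs : s ≤ n) :
    ∃ f : Fin s → Fin n, Function.Injective f ∧ ∀ a,
      (∃ i, f i = a ∧ ∀ i' ≤ i, ∀ b, P a b → P (f i') b) ∨ ∀ i, ∀ b, P a b → P (f i) b := by
  classical
  have := Fintype.ofFinite B
  let c : Fin n → ℤ := fun a => - ((Finset.univ.filter (P a)).card : ℤ)
  let σ := Tuple.sort c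
  have hmono : Monotone (c ∘ σ) := Tuple.monotone_sort c
  have hsub : ∀ k l, k ≤ l → ∀ b, P (σ l) b → P (σ k) b := by
    intro k l hkl b hb
    by_contra hc
    have h1 : (Finset.univ.filter (P (σ k))) ⊆ Finset.univ.filter (P (σ l)) := by
      intro b' hb'
      rcases h _ _ _ _ hb (Finset.mem_filter.1 hb').2 with h' | h'
      · exact Finset.mem_filter.2 ⟨Finset.mem_univ _, h'⟩
      · exact absurd h' hc
    have h2 : (Finset.univ.filter (P (σ k))).card < (Finset.univ.filter (P (σ l))).card :=
      Finset.card_lt_card ⟨h1, fun h' => hc (Finset.mem_filter.1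
        (h' (Finset.mem_filter.2 ⟨Finset.mem_univ _, hb⟩))).2⟩
    have h3 := hmono hkl
    simp only [Function.comp, c] at h3
    omega
  refine ⟨fun i => σ (Fin.castLE hs i), σ.injective.comp (Fin.castLE_injective hs), fun a => ?_⟩
  obtain ⟨k, rfl⟩ := σ.surjective a
  by_cases hk : (k : ℕ) < s
  · exact Or.inl ⟨⟨k, hk⟩, rfl, fun i' hi' => hsub _ _ hi'⟩
  · refine Or.inr fun i => hsub _ _ ?_
    rw [Fin.le_def]
    simp only [Fin.val_castLE]
    omega

/-- If a bipartite graph is not covered by any lists, then its boxicity is large. -/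
lemma not_hasBoxRepresentation_of_uncovered {V : Type*} {G : SimpleGraph V} {n s M d d' : ℕ}
    [NeZero M] (hs : s ≤ n) (ω : Fin n × Fin n → Fin M) (φ ψ : Fin n → V)
    (hne : ∀ a b, φ a ≠ ψ b) (hω : ∀ a b, G.Adj (φ a) (ψ b) ↔ ω (a, b) = 0)
    (hrect : ∀ f g : Fin s → Fin n, Function.Injective f → Function.Injective g →
      ∃ i l, ω (f i, g l) = 0)
    (hcov : ∀ α β : Fin d' × Bool → Fin s → Fin n, (∀ j, Function.Injective (α j)) →
      (∀ j, Function.Injective (β j)) → ¬ IsCoveredBy α β ω) (hd : d ≤ d') :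
    ¬ G.HasBoxRepresentation d := by
  intro hG
  obtain ⟨P, hP, hPadj⟩ := hG.exists_ferrers hd φ ψ hne
  choose α hα1 hα2 using fun j => (hP j).exists_list hs
  choose β hβ1 hβ2 using fun j => (hP j).swap.exists_list hs
  have hPω : ∀ j a b, P j a b → ω (a, b) ≠ 0 := fun j a b h => by
    rw [Ne, ← hω, hPadj]; exact ⟨j, h⟩
  refine hcov α β hα1 hβ1 fun a b hab => ?_
  rw [Ne, ← hω, hPadj] at hab
  obtain ⟨j, hj⟩ := hab
  rcases hα2 j a with ⟨i, hi, h1⟩ | h1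
  · exact Or.inl ⟨j, i, hi, fun i' hi' => hPω j _ _ (h1 i' hi' b hj)⟩
  rcases hβ2 j b with ⟨i, hi, h2⟩ | h2
  · exact Or.inr ⟨j, i, hi, fun i' hi' => hPω j _ _ (h2 i' hi' a hj)⟩
  -- Otherwise the first elements of both lists span an empty rectangle.
  obtain ⟨i, l, hil⟩ := hrect (α j) (β j) (hα1 j) (hβ1 j)
  exact absurd hil (hPω j _ _ (h2 l _ (h1 i _ hj)))

end Ferrers

/-! ### A graph with large boxicity and prescribed maximum degree -/

section StarGraph

variable {n M Δ : ℕ} [NeZero M]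

/-- The disjoint union of the bipartite graph `{(a, b) | ω (a, b) = 0}` and a star with `Δ` leaves.
The star only serves to make the maximum degree equal to `Δ`. -/
def bipartiteWithStar (ω : Fin n × Fin n → Fin M) (Δ : ℕ) :
    SimpleGraph ((Fin n ⊕ Fin n) ⊕ Option (Fin Δ)) :=
  SimpleGraph.fromRel fun u v => match u, v with
    | .inl (.inl a), .inl (.inr b) => ω (a, b) = 0
    | .inr none, .inr (some _) => True
    | _, _ => False

lemma bipartiteWithStar_adj (ω : Fin n × Fin n → Fin M) (a b : Fin n) :
    (bipartiteWithStar ω Δ).Adj (.inl (.inl a)) (.inl (.inr b)) ↔ ω (a, b) = 0 := by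
  simp [bipartiteWithStar]

open Classical in
lemma maxDegree_bipartiteWithStar (ω : Fin n × Fin n → Fin M)
    (h1 : ∀ a, (Finset.univ.filter fun b => ω (a, b) = 0).card ≤ Δ)
    (h2 : ∀ b, (Finset.univ.filter fun a => ω (a, b) = 0).card ≤ Δ) :
    (bipartiteWithStar ω Δ).maxDegree = Δ := by
  have hcenter : ∀ u, u ∈ (bipartiteWithStar ω Δ).neighborFinset (.inr none) ↔
      u ∈ (Finset.univ : Finset (Fin Δ)).image fun i => .inr (some i) := by
    rintro ((u | u) | (_ | u)) <;>
        rw [SimpleGraph.mem_neighborFinset] <;> simp [bipartiteWithStar]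
  have hdeg : (bipartiteWithStar ω Δ).degree (.inr none) = Δ := by
    rw [SimpleGraph.degree, Finset.ext hcenter, Finset.card_image_of_injective _ fun i j hij => by
      simpa using hij]
    simp
  apply le_antisymm
  · apply SimpleGraph.maxDegree_le_of_forall_degree_le
    rintro ((a | b) | (_ | i))
    · refine le_trans (Finset.card_le_card (t := (Finset.univ.filter fun b => ω (a, b) = 0).image
        fun b => .inl (.inr b)) ?_) (Finset.card_image_le.trans (h1 a))
      rintro ((u | u) | (_ | u)) <;>
        rw [SimpleGraph.mem_neighborFinset] <;> simp [bipartiteWithStar]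
    · refine le_trans (Finset.card_le_card (t := (Finset.univ.filter fun a => ω (a, b) = 0).image
        fun a => .inl (.inl a)) ?_) (Finset.card_image_le.trans (h2 b))
      rintro ((u | u) | (_ | u)) <;>
        rw [SimpleGraph.mem_neighborFinset] <;> simp [bipartiteWithStar]
    · exact hdeg.le
    · refine le_trans (Finset.card_le_card (t := {.inr none}) ?_)
        (by simpa using Nat.succ_le_of_lt (i.pos))
      rintro ((u | u) | (_ | u)) <;>
        rw [SimpleGraph.mem_neighborFinset] <;> simp [bipartiteWithStar]
  · exact hdeg.symm.le.trans ((bipartiteWithStar ω Δ).degree_le_maxDegree _)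

/-- The random bipartite graph has parts of size `n` and edge probability `1 / M`; `s` is the length
of the lists, `q` the size from which a prefix counts as long, `τ` the number of short prefixes
allowed for a typical vertex, and `m` the number of disjoint blocks. -/
theorem lt_maxBoxicity_of_parameters {s q τ m d : ℕ} (hM : 2 ≤ M) (hs : 0 < s) (hsn : s ≤ n)
    (hbdd : BddAbove {b : ℕ | ∃ (n : ℕ) (G : SimpleGraph (Fin n)) (_ : DecidableRel G.Adj),
      G.maxDegree = Δ ∧ G.boxicity = b})
    (h : 2 * (d * 2) * (2 * (τ + 1) + q) ≤ n * (τ + 1))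
    (hq : (s : ℝ) * (1 - 1 / (M : ℝ)) ^ q ≤ 1 / 2) (hm : 8 * s ^ 4 * m ≤ n)
    (hdeg : (n : ℝ) * (M * (n.choose (Δ + 1) * (1 / (M : ℝ)) ^ (Δ + 1))) < 1 / 4)
    (hrect : (n : ℝ) ^ (2 * s) * (1 - 1 / (M : ℝ)) ^ (s * s) < 1 / 4)
    (hcov : (n : ℝ) ^ (2 * s * (d * 2)) *
      (1 - (1 / (M : ℝ)) ^ (2 * τ) / 8) ^ (m * m) < 1 / 4) :
    d < maxBoxicity Δ := by
  classical
  obtain ⟨ω, h1, h2, h3, h4⟩ := exists_uncovered_bipartite (A := Fin n) (B := Fin n)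
    (K := Fin d × Bool) (M := M) hM hs (by simp) (by simp) (by simpa using h) hq hm hdeg hrect
    (by simpa using hcov)
  let e := Fintype.equivFin ((Fin n ⊕ Fin n) ⊕ Option (Fin Δ))
  let G := (bipartiteWithStar ω Δ).comap e.symm
  let iso : G ≃g bipartiteWithStar ω Δ := SimpleGraph.Iso.comap e.symm _
  have hmax : G.maxDegree = Δ := by
    rw [iso.maxDegree_eq]
    exact maxDegree_bipartiteWithStar ω h1 h2
  refine lt_of_lt_of_le ?_ (le_csSup hbdd ⟨_, G, inferInstance, hmax, rfl⟩)
  by_contra hc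
  refine not_hasBoxRepresentation_of_uncovered (G := G) (d := G.boxicity) (d' := d) hsn ω
    (fun a => e (.inl (.inl a))) (fun b => e (.inl (.inr b))) (fun a b hab => ?_) (fun a b => ?_)
    h3 h4 (not_lt.1 hc) (Nat.sInf_mem G.exists_hasBoxRepresentation)
  · simpa using e.injective hab
  · simp only [G, SimpleGraph.comap_adj, Equiv.symm_apply_apply]
    exact bipartiteWithStar_adj ω a b

end StarGraph

/-! ### Choice of the parameters in the upper bound -/

section UpperAsymptotics

/-- `(n / e) ^ n ≤ n!` gives an upper bound for binomial coefficients. -/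
lemma choose_mul_inv_pow_le (Δ d : ℕ) {k : ℝ} (hk : 0 < k) :
    (Δ.choose d : ℝ) * (1 / k) ^ d ≤ (Real.exp 1 * Δ / (d * k)) ^ d := by
  rcases Nat.eq_zero_or_pos d with rfl | hd
  · simp
  have hd' : (0 : ℝ) < d := by exact_mod_cast hd
  have h1 : (Δ.choose d : ℝ) ≤ (Δ : ℝ) ^ d / (d.factorial : ℝ) := Nat.choose_le_pow_div d Δ
  have h2 : (d : ℝ) ^ d / (d.factorial : ℝ) ≤ Real.exp d :=
    Real.pow_div_factorial_le_exp _ hd'.le d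
  have hf : (0 : ℝ) < d.factorial := by exact_mod_cast d.factorial_pos
  have h3 : 1 / (d.factorial : ℝ) ≤ (Real.exp 1 / d) ^ d := by
    rw [div_pow, ← Real.exp_nat_mul, mul_one, le_div_iff₀ (by positivity)]
    calc _ = (d : ℝ) ^ d / (d.factorial : ℝ) := by ring
      _ ≤ _ := h2
  calc (Δ.choose d : ℝ) * (1 / k) ^ d ≤ (Δ : ℝ) ^ d / (d.factorial : ℝ) * (1 / k) ^ d := by gcongr
    _ = (Δ : ℝ) ^ d * (1 / k) ^ d * (1 / (d.factorial : ℝ)) := by ring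
    _ ≤ (Δ : ℝ) ^ d * (1 / k) ^ d * (Real.exp 1 / d) ^ d := by gcongr
    _ = _ := by
      rw [← mul_pow, ← mul_pow]
      congr 1
      field_simp

lemma rpow_inv_le_mul_exp {x S d r : ℝ} (hS : 1 ≤ S) (hx : x = Real.exp (S ^ 2)) (hdx : d ≤ 5 * x)
    (hd : 1 ≤ d) (hr : 6 / 5 * S ≤ r) : d ^ (1 / r) ≤ 5 * Real.exp (S / (6 / 5)) := by
  have hx0 : 0 ≤ x := hx ▸ (Real.exp_pos _).le
  have hr0 : 0 < r := by linarith
  have e1 : (5 : ℝ) ^ (1 / r) ≤ 5 := by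
    have := Real.rpow_le_rpow_of_exponent_le (by norm_num : (1 : ℝ) ≤ 5)
      ((div_le_one hr0).2 (by linarith) : 1 / r ≤ 1)
    rwa [Real.rpow_one] at this
  have e2 : x ^ (1 / r) ≤ Real.exp (S / (6 / 5)) := by
    rw [hx, ← Real.exp_mul]
    apply Real.exp_le_exp.2
    rw [mul_one_div, div_le_div_iff₀ hr0 (by norm_num)]
    nlinarith
  calc d ^ (1 / r) ≤ (5 * x) ^ (1 / r) := Real.rpow_le_rpow (by linarith) hdx (by positivity)
    _ = (5 : ℝ) ^ (1 / r) * x ^ (1 / r) := Real.mul_rpow (by norm_num) hx0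
    _ ≤ 5 * Real.exp (S / (6 / 5)) := by gcongr

lemma two_pow_le_mul_exp {S : ℝ} {r : ℕ} (hr : (r : ℝ) ≤ 6 / 5 * S + 1) :
    (2 : ℝ) ^ (r + 1) ≤ 4 * Real.exp (6 / 5 * S * Real.log 2) := by
  have h1 : (2 : ℝ) ^ (r + 1) = (2 : ℝ) ^ ((r : ℝ) + 1) := by
    rw [← Nat.cast_add_one, Real.rpow_natCast]
  have h2 : (2 : ℝ) ^ ((r : ℝ) + 1) ≤ (2 : ℝ) ^ (6 / 5 * S + 2) :=
    Real.rpow_le_rpow_of_exponent_le (by norm_num) (by linarith)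
  have h3 : (2 : ℝ) ^ (6 / 5 * S + 2) = 4 * Real.exp (6 / 5 * S * Real.log 2) := by
    rw [Real.rpow_add (by norm_num), Real.rpow_def_of_pos (by norm_num),
      mul_comm (Real.log 2), Real.rpow_two]
    ring
  rw [h1]
  exact h2.trans_eq h3

/-- A random family of `σ` signings of `b` coordinates restricts to every sign pattern on every
set of `r + 1` coordinates as soon as this union bound is satisfied. -/
lemma pow_mul_one_sub_half_pow_lt_one {b ℓ y : ℝ} {r σ : ℕ} (hb : 0 < b) (hℓ : ℓ = Real.log b)
    (hy : y = 2 ^ (r + 1)) (hσ : y * (r + 1) * ℓ < σ) :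
    b ^ (r + 1) * (1 - (1 / 2) ^ (r + 1)) ^ σ < 1 := by
  have hy1 : 1 ≤ y := hy ▸ one_le_pow₀ (by norm_num)
  have e1 : b ^ (r + 1) = Real.exp ((r + 1) * ℓ) := by
    rw [hℓ, ← Nat.cast_add_one, Real.exp_nat_mul, Real.exp_log hb]
  have e2 : (1 - (1 / 2 : ℝ) ^ (r + 1)) ^ σ ≤ Real.exp (-(σ / y)) := by
    have h1 : 1 - (1 / 2 : ℝ) ^ (r + 1) ≤ Real.exp (-(1 / y)) := by
      have := Real.add_one_le_exp (-(1 / y))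
      rw [div_pow, one_pow, ← hy]
      linarith
    have h0 : 0 ≤ 1 - (1 / 2 : ℝ) ^ (r + 1) := by
      have := pow_le_one₀ (n := r + 1) (by norm_num : (0 : ℝ) ≤ 1 / 2) (by norm_num)
      linarith
    refine (pow_le_pow_left₀ h0 h1 σ).trans_eq ?_
    rw [← Real.exp_nat_mul]
    congr 1
    ring
  rw [e1]
  refine lt_of_le_of_lt (mul_le_mul_of_nonneg_left e2 (Real.exp_pos _).le) ?_
  rw [← Real.exp_add, Real.exp_lt_one_iff]
  have : (r + 1) * ℓ < σ / y := by
    rw [lt_div_iff₀ (by linarith)]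
    linarith
  linarith

lemma mul_exp_mul_exp_le_rpow {S : ℝ} (hS : 0 ≤ S) (hS' : 180 * S ≤ Real.exp (S / 50)) :
    180 * S * (Real.exp (S / (6 / 5)) * Real.exp (6 / 5 * S * Real.log 2)) ≤
      (2 * Real.exp 1) ^ S := by
  have e1 : (2 * Real.exp 1) ^ S = Real.exp (S * (1 + Real.log 2)) := by
    rw [Real.rpow_def_of_pos (by positivity), Real.log_mul (by norm_num)
      (Real.exp_pos 1).ne', Real.log_exp]
    ring_nf
  rw [e1]
  calc _ ≤ Real.exp (S / 50) * (Real.exp (S / (6 / 5)) * Real.exp (6 / 5 * S * Real.log 2)) := by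
        gcongr
    _ = Real.exp (S / 50 + (S / (6 / 5) + 6 / 5 * S * Real.log 2)) := by
        rw [Real.exp_add, Real.exp_add]
    _ ≤ _ := by
        apply Real.exp_le_exp.2
        nlinarith [Real.log_two_lt_d9]

/-- With `r ≈ (6/5) √(log log Δ)`, the factors `d ^ (1 / r)` and `2 ^ r` of the bound in terms of
parameters multiply to `exp (c √(log log Δ))` with `c = 5/6 + (6/5) log 2 < 1 + log 2`, and the
difference absorbs all lower order factors. -/
lemma exists_upper_parameters (Δ : ℕ) {x L S : ℝ} (hx : Real.log Δ = x) (hL : Real.log x = L)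
    (hS : √L = S) (hS10 : 10 ≤ S) (hS' : 180 * S ≤ Real.exp (S / 50)) :
    ∃ N : ℕ, (N : ℝ) ≤ 180 * Δ * x * (2 * Real.exp 1) ^ S * L ∧
      ∀ (V : Type*) [Fintype V] (G : SimpleGraph V) [DecidableRel G.Adj],
        (∀ v, G.degree v ≤ Δ) → G.HasBoxRepresentation N := by
  have hL0 : 0 < L := by
    by_contra h
    rw [Real.sqrt_eq_zero_of_nonpos (not_lt.1 h)] at hS
    linarith
  have hLS : L = S ^ 2 := by rw [← hS, Real.sq_sqrt hL0.le]
  have hL100 : 100 ≤ L := by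
    rw [hLS, show (100 : ℝ) = 10 ^ 2 by norm_num]
    gcongr
  have hx0 : 0 < x := by
    have hx1 : x ≠ 0 := by rintro rfl; simp at hL; linarith
    rcases lt_or_gt_of_ne hx1 with h | h
    · have : 0 ≤ x := by rw [← hx]; exact Real.log_natCast_nonneg Δ
      linarith
    · exact h
  have hxL : x = Real.exp L := by rw [← hL, Real.exp_log hx0]
  have hxL2 : 1 + L + L ^ 2 / 2 ≤ x := hxL ▸ Real.quadratic_le_exp_of_nonneg hL0.le
  have hx100 : 5000 ≤ x := by
    have : (100 : ℝ) ^ 2 ≤ L ^ 2 := by gcongr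
    linarith
  have hΔ0 : (0 : ℝ) < Δ := by
    rcases Nat.eq_zero_or_pos Δ with rfl | h
    · simp at hx; linarith
    · exact_mod_cast h
  have hΔx : (Δ : ℝ) = Real.exp x := by rw [← hx, Real.exp_log hΔ0]
  have hΔx2 : 1 + x + x ^ 2 / 2 ≤ Δ := hΔx ▸ Real.quadratic_le_exp_of_nonneg hx0.le
  have hΔ5 : 5 * x ≤ Δ := by
    have : 5000 * x ≤ x ^ 2 := by rw [sq]; gcongr
    linarith
  have hΔ1 : (10000 : ℝ) ≤ Δ := by linarith
  -- the degree into a part, which also serves as the number of colourings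
  obtain ⟨d, hd⟩ : ∃ d, d = ⌈4 * x⌉₊ := ⟨_, rfl⟩
  have hd1 : 4 * x ≤ d := hd ▸ Nat.le_ceil _
  have hd2 : (d : ℝ) ≤ 4 * x + 1 := hd ▸ (Nat.ceil_lt_add_one (by positivity)).le
  obtain ⟨k, hk⟩ : ∃ k, k = ⌈8 * (Δ : ℝ) / (d + 1 : ℝ)⌉₊ := ⟨_, rfl⟩
  have hdpos : (0 : ℝ) < d + 1 := by linarith
  have hk1 : 8 * (Δ : ℝ) / (d + 1 : ℝ) ≤ k := hk ▸ Nat.le_ceil _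
  have hk2 : (k : ℝ) ≤ 8 * (Δ : ℝ) / (d + 1 : ℝ) + 1 :=
    hk ▸ (Nat.ceil_lt_add_one (by positivity)).le
  have hkpos : (0 : ℝ) < k := lt_of_lt_of_le (by positivity) hk1
  have hkd : (k : ℝ) * (d + 1) ≤ 9 * Δ := by
    have h1 : (k : ℝ) * (d + 1) ≤ (8 * (Δ : ℝ) / (d + 1 : ℝ) + 1) * (d + 1) := by gcongr
    have h2 : (8 * (Δ : ℝ) / (d + 1 : ℝ) + 1) * (d + 1) = 8 * Δ + (d + 1) := by field_simp
    linarith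
  have hkΔ : (k : ℝ) ≤ Δ := by
    have : (k : ℝ) * 9 ≤ k * (d + 1) := by gcongr; linarith
    linarith
  have hk8 : 8 * (Δ : ℝ) ≤ k * (d + 1) := by rwa [div_le_iff₀ hdpos] at hk1
  have hexpd : Real.exp (-(d : ℝ)) * Δ ^ 4 ≤ 1 := by
    rw [hΔx, ← Real.exp_nat_mul, ← Real.exp_add, Real.exp_le_one_iff]
    push_cast; linarith
  have hsmall : 4 * ((k : ℝ) * Real.exp (-(d : ℝ))) * ((Δ : ℝ) ^ 2 + 1) ≤ 1 := by
    have he := Real.exp_pos (-(d : ℝ))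
    calc 4 * ((k : ℝ) * Real.exp (-(d : ℝ))) * ((Δ : ℝ) ^ 2 + 1)
        ≤ 4 * ((Δ : ℝ) * Real.exp (-(d : ℝ))) * (2 * (Δ : ℝ) ^ 2) := by
          gcongr
          have : (1 : ℝ) ≤ (Δ : ℝ) ^ 2 := one_le_pow₀ (by linarith)
          linarith
      _ = Real.exp (-(d : ℝ)) * (8 * Δ ^ 3) := by ring
      _ ≤ Real.exp (-(d : ℝ)) * (Δ * Δ ^ 3) := by gcongr; linarith
      _ = Real.exp (-(d : ℝ)) * Δ ^ 4 := by ring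
      _ ≤ 1 := hexpd
  have hpart : 4 * (k * (Δ.choose (d + 1) * (1 / (k : ℝ)) ^ (d + 1))) * ((Δ : ℝ) ^ 2 + 1) ≤ 1 := by
    refine le_trans ?_ hsmall
    gcongr
    refine (choose_mul_inv_pow_le Δ (d + 1) hkpos).trans ?_
    have he8 : Real.exp 1 * Real.exp 1 ≤ 8 := by
      have : Real.exp 1 ≤ 2.8 := by linarith [Real.exp_one_lt_d9]
      calc Real.exp 1 * Real.exp 1 ≤ 2.8 * 2.8 := by gcongr
        _ ≤ 8 := by norm_num
    have h1 : Real.exp 1 * Δ / (((d + 1 : ℕ) : ℝ) * k) ≤ Real.exp (-1) := by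
      rw [div_le_iff₀ (by push_cast; positivity), Real.exp_neg, ← div_eq_inv_mul,
        le_div_iff₀ (Real.exp_pos 1)]
      push_cast
      calc Real.exp 1 * Δ * Real.exp 1 = Real.exp 1 * Real.exp 1 * Δ := by ring
        _ ≤ 8 * Δ := by gcongr
        _ ≤ (d + 1) * k := by linarith
    calc (Real.exp 1 * Δ / (((d + 1 : ℕ) : ℝ) * k)) ^ (d + 1)
        ≤ Real.exp (-1) ^ (d + 1) := pow_le_pow_left₀ (by positivity) h1 _
      _ = Real.exp (-((d : ℝ) + 1)) := by rw [← Real.exp_nat_mul]; push_cast; ring_nf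
      _ ≤ Real.exp (-(d : ℝ)) := Real.exp_le_exp.2 (by linarith)
  have hcol : 4 * (k * (1 / 3 : ℝ) ^ d) * ((Δ : ℝ) ^ 2 + 1) ≤ 1 := by
    refine le_trans ?_ hsmall
    gcongr
    rw [← mul_one (-(d : ℝ)), neg_mul, ← mul_neg, Real.exp_nat_mul]
    gcongr
    rw [Real.exp_neg, one_div]
    apply inv_anti₀ (Real.exp_pos 1)
    linarith [Real.exp_one_lt_d9]
  -- the bound on the number of neighbours in a colour class
  obtain ⟨r, hr⟩ : ∃ r, r = ⌈6 / 5 * S⌉₊ := ⟨_, rfl⟩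
  have hr1 : 6 / 5 * S ≤ r := hr ▸ Nat.le_ceil _
  have hr2 : (r : ℝ) ≤ 6 / 5 * S + 1 := hr ▸ (Nat.ceil_lt_add_one (by positivity)).le
  have hrpos : (0 : ℝ) < r := by linarith
  have hr0 : 1 ≤ r := by exact_mod_cast (by linarith : (1 : ℝ) ≤ r)
  -- the number of colours is `3 d w`, with `w` the least integer such that `d ≤ w ^ r`
  obtain ⟨w, hw⟩ : ∃ w, w = ⌈(d : ℝ) ^ (1 / (r : ℝ))⌉₊ := ⟨_, rfl⟩
  have hd0 : (1 : ℝ) ≤ d := by linarith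
  have hw1 : (d : ℝ) ^ (1 / (r : ℝ)) ≤ w := hw ▸ Nat.le_ceil _
  have hdr : 1 ≤ (d : ℝ) ^ (1 / (r : ℝ)) := Real.one_le_rpow hd0 (by positivity)
  have hw2 : (w : ℝ) ≤ 2 * (d : ℝ) ^ (1 / (r : ℝ)) := by
    have : (w : ℝ) ≤ (d : ℝ) ^ (1 / (r : ℝ)) + 1 :=
      hw ▸ (Nat.ceil_lt_add_one (by positivity)).le
    linarith
  have hwd : d ≤ w ^ r := by
    have h1 : ((d : ℝ) ^ (1 / (r : ℝ))) ^ r = d := by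
      rw [← Real.rpow_natCast, ← Real.rpow_mul (by linarith), one_div,
        inv_mul_cancel₀ hrpos.ne', Real.rpow_one]
    have h2 : ((d : ℝ) ^ (1 / (r : ℝ))) ^ r ≤ (w : ℝ) ^ r := pow_le_pow_left₀ (by linarith) hw1 _
    rw [h1] at h2
    exact_mod_cast h2
  have hwle : (w : ℝ) ≤ 10 * Real.exp (S / (6 / 5)) := by
    have h1 : (d : ℝ) ≤ 5 * x := by linarith
    have h2 := rpow_inv_le_mul_exp (by linarith) (hxL.trans (by rw [hLS])) h1 hd0 hr1
    linarith
  obtain ⟨y, hy⟩ : ∃ y : ℝ, y = 2 ^ (r + 1) := ⟨_, rfl⟩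
  have hy1 : 1 ≤ y := hy ▸ one_le_pow₀ (by norm_num)
  have hyle : y ≤ 4 * Real.exp (6 / 5 * S * Real.log 2) := hy ▸ two_pow_le_mul_exp hr2
  -- colours of the square of the graph are written with `2 d` bits
  have hb : (Δ + 1) ^ 2 + 1 ≤ 2 ^ (2 * d) := by
    have h1 : (Δ : ℝ) ^ 4 ≤ 4 ^ d := by
      calc (Δ : ℝ) ^ 4 = Real.exp (4 * x) := by rw [hΔx, ← Real.exp_nat_mul]; push_cast; rfl
        _ ≤ Real.exp d := Real.exp_le_exp.2 hd1
        _ = Real.exp 1 ^ d := by rw [← Real.exp_nat_mul, mul_one]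
        _ ≤ 4 ^ d := by gcongr; linarith [Real.exp_one_lt_d9]
    have h2 : ((Δ : ℝ) + 1) ^ 2 + 1 ≤ Δ ^ 4 := by
      have h3 : 10000 * (Δ : ℝ) ≤ (Δ : ℝ) ^ 2 := by rw [sq]; gcongr
      have h4 : (10000 : ℝ) ≤ (Δ : ℝ) ^ 2 := by linarith
      calc ((Δ : ℝ) + 1) ^ 2 + 1 = (Δ : ℝ) ^ 2 + 2 * Δ + 2 := by ring
        _ ≤ 10000 * (Δ : ℝ) ^ 2 := by linarith
        _ ≤ (Δ : ℝ) ^ 2 * (Δ : ℝ) ^ 2 := by gcongr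
        _ = (Δ : ℝ) ^ 4 := by ring
    have h3 : ((Δ : ℝ) + 1) ^ 2 + 1 ≤ 4 ^ d := h2.trans h1
    rw [pow_mul]
    norm_num
    exact_mod_cast h3
  -- the number of sign vectors
  obtain ⟨ℓ, hℓ⟩ : ∃ ℓ, ℓ = Real.log (2 * (((2 * d : ℕ) : ℝ) + 1)) := ⟨_, rfl⟩
  have harg : (0 : ℝ) < 2 * (((2 * d : ℕ) : ℝ) + 1) := by positivity
  have hℓ0 : 0 ≤ ℓ := hℓ ▸ Real.log_nonneg (by push_cast; linarith)
  have hℓ2 : ℓ ≤ 2 * L := by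
    have h1 : Real.exp (2 * L) = x * x := by rw [two_mul, Real.exp_add, ← hxL]
    rw [hℓ, Real.log_le_iff_le_exp harg, h1]
    have h2 : 5000 * x ≤ x * x := by gcongr
    push_cast
    linarith
  obtain ⟨σ, hσdef⟩ : ∃ σ, σ = ⌈y * (r + 1) * ℓ⌉₊ + 1 := ⟨_, rfl⟩
  have hσ1 : y * (r + 1) * ℓ < σ := by
    rw [hσdef]; push_cast
    linarith [Nat.le_ceil (y * (r + 1) * ℓ)]
  have hσ2 : (σ : ℝ) ≤ y * (r + 1) * ℓ + 2 := by
    rw [hσdef]; push_cast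
    linarith [Nat.ceil_lt_add_one (a := y * (r + 1) * ℓ) (by positivity)]
  have hσ : (2 * (((2 * d : ℕ) : ℝ) + 1) : ℝ) ^ (r + 1) * (1 - (1 / 2) ^ (r + 1)) ^ σ < 1 :=
    pow_mul_one_sub_half_pow_lt_one harg hℓ hy hσ1
  have hσle : (σ : ℝ) ≤ y * (6 * S * L) := by
    have h1 : y * (r + 1) * ℓ ≤ y * (2 * S) * (2 * L) := by
      gcongr
      linarith
    have h2 : 1 * (2 * 10 * 100) ≤ y * (2 * S * L) := by gcongr
    linarith
  refine ⟨k * (d * (3 * d * w * σ)), ?_, fun V _ G _ hdeg => ?_⟩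
  · have hexp := mul_exp_mul_exp_le_rpow (by linarith) hS'
    have hd5 : (d : ℝ) ≤ 5 * x := by linarith
    have hkd' : (k : ℝ) * d ≤ 9 * Δ := by linarith
    push_cast
    calc (k : ℝ) * (d * (3 * d * w * σ)) = 3 * (k * d) * d * w * σ := by ring
      _ ≤ 3 * (9 * Δ) * (5 * x) * (10 * Real.exp (S / (6 / 5))) *
          ((4 * Real.exp (6 / 5 * S * Real.log 2)) * (6 * S * L)) := by
          gcongr
          exact hσle.trans (by gcongr)
      _ = 180 * Δ * x * (180 * S *
          (Real.exp (S / (6 / 5)) * Real.exp (6 / 5 * S * Real.log 2))) * L := by ring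
      _ ≤ _ := by gcongr
  · classical
    exact G.hasBoxRepresentation_of_parameters hdeg (by exact_mod_cast hkpos) hr0
      (by exact_mod_cast hd0) hwd hpart hcol hb hσ

lemma eventually_log_log_sqrt (P : ℝ → Prop) (h : ∀ᶠ S in atTop, P S) :
    ∀ᶠ Δ : ℕ in atTop, P (√(Real.log (Real.log Δ))) :=
  (Real.tendsto_sqrt_atTop.comp (Real.tendsto_log_atTop.comp (Real.tendsto_log_atTop.comp
    tendsto_natCast_atTop_atTop))).eventually h

/-- The upper bound without an error term in the constant. -/
theorem eventually_boxicity_le : ∀ᶠ Δ : ℕ in atTop,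
    ∀ (V : Type*) [Fintype V] (G : SimpleGraph V) [DecidableRel G.Adj], G.maxDegree = Δ →
      (G.boxicity : ℝ) ≤ 180 * (Δ : ℝ) * Real.log Δ *
        (2 * Real.exp 1) ^ √(Real.log (Real.log Δ)) * Real.log (Real.log Δ) := by
  have h1 : ∀ᶠ S : ℝ in atTop, 10 ≤ S ∧ 180 * S ≤ Real.exp (S / 50) := by
    have ht : Tendsto (fun S : ℝ => Real.exp (S / 50) / (S / 50)) atTop atTop := by
      have := (Real.tendsto_exp_div_pow_atTop 1).comp
        (tendsto_id.atTop_div_const (by norm_num : (0 : ℝ) < 50))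
      simpa [Function.comp_def] using this
    filter_upwards [eventually_ge_atTop 10, ht.eventually_ge_atTop 9000] with S hS h
    refine ⟨hS, ?_⟩
    rw [le_div_iff₀ (by positivity)] at h
    linarith
  filter_upwards [eventually_log_log_sqrt _ h1] with Δ hΔ V _ G _ hG
  obtain ⟨N, hN, hbox⟩ := exists_upper_parameters Δ rfl rfl rfl hΔ.1 hΔ.2
  have := hbox V G fun v => hG ▸ G.degree_le_maxDegree v
  have hle : G.boxicity ≤ N := Nat.sInf_le this
  exact le_trans (by exact_mod_cast hle) hN

end UpperAsymptotics

/-! ### Choice of the parameters in the lower bound -/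

section LowerAsymptotics

lemma one_sub_pow_le_exp {a : ℝ} (ha : a ≤ 1) (j : ℕ) : (1 - a) ^ j ≤ Real.exp (-(a * j)) := by
  have h := Real.add_one_le_exp (-a)
  calc (1 - a) ^ j ≤ Real.exp (-a) ^ j := pow_le_pow_left₀ (by linarith) (by linarith) j
    _ = Real.exp (-(a * j)) := by rw [← Real.exp_nat_mul]; ring_nf

lemma exp_neg_lt_quarter {a : ℝ} (ha : 2 ≤ a) : Real.exp (-a) < 1 / 4 := by
  have h : Real.exp (-a) ≤ Real.exp (-1) * Real.exp (-1) := by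
    rw [← Real.exp_add]; exact Real.exp_le_exp.2 (by linarith)
  have h1 : Real.exp (-1) < 1 / 2 := by
    rw [Real.exp_neg, ← one_div]
    apply one_div_lt_one_div_of_lt (by norm_num)
    linarith [Real.exp_one_gt_d9]
  nlinarith [Real.exp_pos (-1)]

/-- The union bound for the maximum degree of a random bipartite graph with parts of size `Δ k`
and edge probability `1 / (16 k)`. -/
lemma mul_choose_lt_quarter {Δ k : ℕ} (hk : 0 < k) (hkΔ : 64 * (k : ℝ) ^ 2 ≤ Δ) :
    ((Δ * k : ℕ) : ℝ) * ((16 * k : ℕ) * ((Δ * k).choose (Δ + 1) *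
      (1 / ((16 * k : ℕ) : ℝ)) ^ (Δ + 1))) < 1 / 4 := by
  have hk' : (1 : ℝ) ≤ k := by exact_mod_cast hk
  have hΔ64 : (64 : ℝ) ≤ Δ := by nlinarith
  have hM : (0 : ℝ) < ((16 * k : ℕ) : ℝ) := by push_cast; linarith
  have h1 := choose_mul_inv_pow_le (Δ * k) (Δ + 1) hM
  have h2 : Real.exp 1 * ((Δ * k : ℕ) : ℝ) / (((Δ + 1 : ℕ) : ℝ) * ((16 * k : ℕ) : ℝ)) ≤
      Real.exp (-1) := by
    have he := Real.exp_pos 1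
    have he16 : Real.exp 1 * Real.exp 1 ≤ 16 := by nlinarith [Real.exp_one_lt_d9]
    push_cast
    rw [div_le_iff₀ (by positivity), Real.exp_neg, ← div_eq_inv_mul, le_div_iff₀ he]
    calc Real.exp 1 * (Δ * k) * Real.exp 1 = (Real.exp 1 * Real.exp 1) * (Δ * k) := by ring
      _ ≤ 16 * ((Δ + 1) * k) := by gcongr; linarith
      _ = _ := by ring
  have h3 : ((Δ * k).choose (Δ + 1) : ℝ) * (1 / ((16 * k : ℕ) : ℝ)) ^ (Δ + 1) ≤
      Real.exp (-((Δ : ℝ) + 1)) := by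
    refine h1.trans ((pow_le_pow_left₀ (by positivity) h2 _).trans_eq ?_)
    rw [← Real.exp_nat_mul]; push_cast; ring_nf
  have h4 : (Δ : ℝ) ^ 2 ≤ Real.exp Δ := by
    have := Real.pow_div_factorial_le_exp (Δ : ℝ) (by positivity) 3
    rw [show Nat.factorial 3 = 6 from rfl] at this
    push_cast at this
    have h5 : (Δ : ℝ) ^ 2 * 6 ≤ (Δ : ℝ) ^ 2 * Δ := by gcongr; linarith
    have h6 : (Δ : ℝ) ^ 2 * Δ = Δ ^ 3 := by ring
    linarith
  calc _ ≤ ((Δ * k : ℕ) : ℝ) * ((16 * k : ℕ) * Real.exp (-((Δ : ℝ) + 1))) := by gcongr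
    _ = (64 * (k : ℝ) ^ 2) * Δ * Real.exp (-((Δ : ℝ) + 1)) / 4 := by push_cast; ring
    _ ≤ (Δ * Δ) * Real.exp (-((Δ : ℝ) + 1)) / 4 := by gcongr
    _ ≤ Real.exp Δ * Real.exp (-((Δ : ℝ) + 1)) / 4 := by gcongr; linarith
    _ = Real.exp (-1) / 4 := by rw [← Real.exp_add]; ring_nf
    _ < 1 / 4 := by
      have : Real.exp (-1) < 1 := Real.exp_lt_one_iff.2 (by norm_num)
      linarith

/-- The union bound for empty rectangles with both sides of size `100 k ^ 2`. -/
lemma pow_mul_one_sub_inv_pow_lt_quarter {n k : ℕ} (hk : 0 < k)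
    (hn : (n : ℝ) ≤ Real.exp (2 * k)) :
    (n : ℝ) ^ (2 * (100 * k ^ 2)) *
      (1 - 1 / ((16 * k : ℕ) : ℝ)) ^ ((100 * k ^ 2) * (100 * k ^ 2)) < 1 / 4 := by
  have hk' : (1 : ℝ) ≤ k := by exact_mod_cast hk
  have h0 : 1 / ((16 * k : ℕ) : ℝ) ≤ 1 := by
    rw [div_le_one (by push_cast; linarith)]; push_cast; linarith
  calc _ ≤ Real.exp (2 * k) ^ (2 * (100 * k ^ 2)) *
        Real.exp (-(1 / ((16 * k : ℕ) : ℝ) * ((100 * k ^ 2) * (100 * k ^ 2) : ℕ))) := by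
        have h := one_sub_pow_le_exp h0 ((100 * k ^ 2) * (100 * k ^ 2))
        have hb : (0 : ℝ) ≤ (1 - 1 / ((16 * k : ℕ) : ℝ)) ^ ((100 * k ^ 2) * (100 * k ^ 2)) :=
          pow_nonneg (by linarith) _
        exact mul_le_mul (pow_le_pow_left₀ (by positivity) hn _) h hb (by positivity)
    _ = Real.exp (-(225 * k ^ 3)) := by
        rw [← Real.exp_nat_mul, ← Real.exp_add]
        congr 1
        push_cast
        field_simp
        ring
    _ < 1 / 4 := by
        apply exp_neg_lt_quarter
        have : (1 : ℝ) ≤ k ^ 3 := one_le_pow₀ hk'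
        linarith

/-- The union bound over all configurations of lists. The probability that a configuration is
covered decays with the square of the number `m` of disjoint blocks, and `m` is linear in `n` up
to logarithmic factors, whereas the number of configurations is only `exp (O (n))` up to such
factors in the exponent. -/
lemma pow_mul_one_sub_pow_sq_lt_quarter {n k s d m M τ : ℕ} {R : ℝ} (hk : 0 < k) (hs : 0 < s)
    (hn : (n : ℝ) ≤ Real.exp (2 * k)) (hd : 8 * d ≤ n) (hm : (n : ℝ) ≤ 16 * s ^ 4 * m)
    (hn0 : 0 < n) (hM : 1 ≤ M) (hR0 : 0 < R) (hR : (M : ℝ) ^ (2 * τ) ≤ R)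
    (hbig : 8192 * k * (s : ℝ) ^ 9 * R ≤ n) :
    (n : ℝ) ^ (2 * s * (d * 2)) * (1 - (1 / (M : ℝ)) ^ (2 * τ) / 8) ^ (m * m) < 1 / 4 := by
  have hk' : (1 : ℝ) ≤ k := by exact_mod_cast hk
  have hs' : (1 : ℝ) ≤ s := by exact_mod_cast hs
  have hn1 : (1 : ℝ) ≤ n := by exact_mod_cast hn0
  have hM' : (1 : ℝ) ≤ M := by exact_mod_cast hM
  have hMτ : (1 : ℝ) ≤ (M : ℝ) ^ (2 * τ) := one_le_pow₀ hM'
  have hd' : 8 * (d : ℝ) ≤ n := by exact_mod_cast hd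
  have hρ1 : (1 / (M : ℝ)) ^ (2 * τ) / 8 ≤ 1 := by
    have : (1 / (M : ℝ)) ^ (2 * τ) ≤ 1 :=
      pow_le_one₀ (by positivity) ((div_le_one (by linarith)).2 hM')
    linarith
  have hρ : 1 / (8 * R) ≤ (1 / (M : ℝ)) ^ (2 * τ) / 8 := by
    rw [one_div_pow, div_div, mul_comm 8 R]
    exact one_div_le_one_div_of_le (by positivity) (by linarith)
  have hmain : 4 * k * s * n ≤ 1 / (8 * R) * (m * m : ℕ) := by
    rw [div_mul_eq_mul_div, one_mul, le_div_iff₀ (by positivity)]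
    push_cast
    have h1 : (n : ℝ) * n ≤ (16 * s ^ 4 * m) * (16 * s ^ 4 * m) := by gcongr
    have h2 : 8192 * k * (s : ℝ) ^ 9 * R * n ≤ n * n := by gcongr
    have h3 : (256 * (s : ℝ) ^ 8) * (4 * k * s * n * (8 * R)) ≤ (256 * (s : ℝ) ^ 8) * (m * m) := by
      linarith
    exact le_of_mul_le_mul_left h3 (by positivity)
  calc _ ≤ Real.exp (2 * k) ^ (2 * s * (d * 2)) *
        Real.exp (-((1 / (M : ℝ)) ^ (2 * τ) / 8 * (m * m : ℕ))) :=
        mul_le_mul (pow_le_pow_left₀ (by positivity) hn _) (one_sub_pow_le_exp hρ1 _)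
          (pow_nonneg (by linarith) _) (by positivity)
    _ ≤ Real.exp (k * s * n) * Real.exp (-(4 * k * s * n)) := by
        rw [← Real.exp_nat_mul]
        refine mul_le_mul (Real.exp_le_exp.2 ?_) (Real.exp_le_exp.2 (neg_le_neg ?_))
          (Real.exp_pos _).le (Real.exp_pos _).le
        · push_cast
          have : (k : ℝ) * s * (8 * d) ≤ k * s * n := by gcongr
          linarith
        · exact hmain.trans (mul_le_mul_of_nonneg_right hρ (Nat.cast_nonneg _))
    _ = Real.exp (-(3 * k * s * n)) := by rw [← Real.exp_add]; ring_nf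
    _ < 1 / 4 := by
        apply exp_neg_lt_quarter
        have : (1 : ℝ) ≤ k * s * n := one_le_mul_of_one_le_of_one_le
          (one_le_mul_of_one_le_of_one_le hk' hs') hn1
        linarith

lemma exists_nat_log_le_le {x L : ℝ} {k : ℕ} (hx : 1 ≤ x) (hL : Real.log x = L) (hL8 : 8 ≤ L)
    (hk1 : (1 : ℝ) ≤ k) (hk : (k : ℝ) ≤ 2 * x) :
    ∃ l : ℕ, Real.log (200 * k ^ 2) ≤ l ∧ (l : ℝ) ≤ 3 * L := by
  have hxL : x = Real.exp L := by rw [← hL, Real.exp_log (by linarith)]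
  refine ⟨⌈Real.log (200 * k ^ 2)⌉₊, Nat.le_ceil _, ?_⟩
  have h1 := (Nat.ceil_lt_add_one (Real.log_nonneg (by nlinarith : 1 ≤ 200 * (k : ℝ) ^ 2))).le
  have h2 : Real.log (200 * (k : ℝ) ^ 2) ≤ 2 * L + 7 := by
    rw [Real.log_le_iff_le_exp (by positivity), Real.exp_add, two_mul, Real.exp_add, ← hxL]
    have h3 : (800 : ℝ) ≤ Real.exp 7 := by
      have h4 : Real.exp 7 = Real.exp 1 ^ 7 := by rw [← Real.exp_nat_mul]; norm_num
      rw [h4]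
      calc (800 : ℝ) ≤ 2.7 ^ 7 := by norm_num
        _ ≤ _ := by gcongr; linarith [Real.exp_one_gt_d9]
    calc 200 * (k : ℝ) ^ 2 ≤ 200 * (2 * x) ^ 2 := by gcongr
      _ = x * x * 800 := by ring
      _ ≤ _ := by gcongr
  linarith

/-- The lower bound on `bx(Δ)` for given values of the parameters `k ≈ log Δ` and
`l ≈ log log Δ`. -/
lemma le_maxBoxicity_mul_of_parameters {Δ k l : ℕ} {x : ℝ} (hΔx : (Δ : ℝ) = Real.exp x)
    (hk1 : x ≤ k) (hk2 : (k : ℝ) ≤ 2 * x) (hk0 : 0 < k) (hl0 : 0 < l)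
    (hkbig : 10 ^ 22 * (k : ℝ) ^ 19 ≤ Real.exp (x / 2))
    (hexpl : 200 * (k : ℝ) ^ 2 ≤ Real.exp l)
    (hbdd : BddAbove {b : ℕ | ∃ (n : ℕ) (G : SimpleGraph (Fin n)) (_ : DecidableRel G.Adj),
      G.maxDegree = Δ ∧ G.boxicity = b}) :
    Δ * x ≤ 520 * l ^ 2 * maxBoxicity Δ := by
  have hk1' : (1 : ℝ) ≤ k := by exact_mod_cast hk0
  have hl1' : (1 : ℝ) ≤ l := by exact_mod_cast hl0
  have hx0 : 0 ≤ x := by linarith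
  have hΔ0 : (0 : ℝ) < Δ := hΔx ▸ Real.exp_pos _
  have hΔh : (Δ : ℝ) = Real.exp (x / 2) * Real.exp (x / 2) := by
    rw [hΔx, ← Real.exp_add]; ring_nf
  have hexp1 : 1 ≤ Real.exp (x / 2) := Real.one_le_exp (by linarith)
  have hkΔ : 10 ^ 22 * (k : ℝ) ^ 19 ≤ Δ := by nlinarith
  -- `τ` short prefixes are met with probability `(16 k) ^ (-τ) ≥ Δ ^ (-1/4)`, as `16 k ≤ exp l`.
  obtain ⟨τ, hτ⟩ : ∃ τ, τ = ⌊x / (4 * l)⌋₊ := ⟨_, rfl⟩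
  have hτ1 : (τ : ℝ) ≤ x / (4 * l) := hτ ▸ Nat.floor_le (by positivity)
  have hτ2 : x / (4 * l) ≤ (τ : ℝ) + 1 := hτ ▸ (Nat.lt_floor_add_one _).le
  obtain ⟨n, hn⟩ : ∃ n, n = Δ * k := ⟨_, rfl⟩
  obtain ⟨s, hs⟩ : ∃ s, s = 100 * k ^ 2 := ⟨_, rfl⟩
  have hs' : (s : ℝ) = 100 * k ^ 2 := by rw [hs]; push_cast; rfl
  have hs0 : 0 < s := by rw [hs]; positivity
  have hn' : (n : ℝ) = Δ * k := by rw [hn]; push_cast; rfl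
  have hΔn : (Δ : ℝ) ≤ n := by rw [hn']; nlinarith
  have hn0 : 0 < n := by exact_mod_cast hΔ0.trans_le hΔn
  have hkpow : ∀ i : ℕ, i ≤ 19 → 10 ^ 22 * (k : ℝ) ^ i ≤ Δ := fun i hi =>
    le_trans (by gcongr) hkΔ
  have hs4 : 8 * s ^ 4 ≤ n := by
    have h1 : 8 * (s : ℝ) ^ 4 ≤ n := by
      calc 8 * (s : ℝ) ^ 4 = 8 * 10 ^ 8 * (k : ℝ) ^ 8 := by rw [hs']; ring
        _ ≤ 10 ^ 22 * (k : ℝ) ^ 8 := by gcongr; norm_num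
        _ ≤ n := (hkpow 8 (by norm_num)).trans hΔn
    exact_mod_cast h1
  obtain ⟨m, hm⟩ : ∃ m, m = n / (8 * s ^ 4) := ⟨_, rfl⟩
  have hm1 : 8 * s ^ 4 * m ≤ n := hm ▸ Nat.mul_div_le _ _
  have hm2 : (n : ℝ) ≤ 16 * s ^ 4 * m := by
    have h1 : n < 8 * s ^ 4 * (m + 1) := by
      rw [hm]
      exact Nat.lt_mul_div_succ _ (by positivity)
    have h2 : 1 ≤ m := by rw [hm]; exact (Nat.one_le_div_iff (by positivity)).2 hs4
    have h3 : n ≤ 16 * s ^ 4 * m := by nlinarith [Nat.zero_le (s ^ 4)]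
    exact_mod_cast h3
  -- A prefix with `16 k l` elements is missed with probability at most `exp (-l) ≤ 1 / (2 s)`.
  obtain ⟨q, hq⟩ : ∃ q, q = 16 * k * l := ⟨_, rfl⟩
  obtain ⟨d, hd⟩ : ∃ d, d = n * (τ + 1) / (4 * (2 * (τ + 1) + q)) := ⟨_, rfl⟩
  have hd1 : 4 * (2 * (τ + 1) + q) * d ≤ n * (τ + 1) := hd ▸ Nat.mul_div_le _ _
  have hd2 : n * (τ + 1) < 4 * (2 * (τ + 1) + q) * (d + 1) := by
    rw [hd]
    exact Nat.lt_mul_div_succ _ (by positivity)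
  have hd8 : 8 * d ≤ n := by
    have : (τ + 1) * (8 * d) ≤ (τ + 1) * n := by
      calc (τ + 1) * (8 * d) ≤ (τ + 1) * (8 * d) + 4 * q * d := Nat.le_add_right _ _
        _ = 4 * (2 * (τ + 1) + q) * d := by ring
        _ ≤ n * (τ + 1) := hd1
        _ = (τ + 1) * n := mul_comm _ _
    exact Nat.le_of_mul_le_mul_left this (by positivity)
  have hn2k : (n : ℝ) ≤ Real.exp (2 * k) := by
    rw [hn', two_mul, Real.exp_add, hΔx]
    gcongr
    linarith [Real.add_one_le_exp (k : ℝ)]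
  have hlt : d < maxBoxicity Δ := by
    have : NeZero (16 * k) := ⟨by positivity⟩
    have hM1 : (1 : ℝ) ≤ ((16 * k : ℕ) : ℝ) := by push_cast; linarith
    have hMe : ((16 * k : ℕ) : ℝ) ≤ Real.exp l := by push_cast; nlinarith
    refine lt_maxBoxicity_of_parameters (n := n) (M := 16 * k) (s := s) (q := q) (τ := τ) (m := m)
      (by linarith) hs0 ?_ hbdd ?_ ?_ hm1 ?_ ?_ ?_
    · have : 8 * s ^ 4 = s * (8 * s ^ 3) := by ring
      exact le_trans (Nat.le_mul_of_pos_right s (by positivity)) (this ▸ hs4)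
    · calc 2 * (d * 2) * (2 * (τ + 1) + q) = 4 * (2 * (τ + 1) + q) * d := by ring
        _ ≤ n * (τ + 1) := hd1
    · have h1 : 1 / ((16 * k : ℕ) : ℝ) ≤ 1 := (div_le_one (by linarith)).2 hM1
      calc (s : ℝ) * (1 - 1 / ((16 * k : ℕ) : ℝ)) ^ q ≤ s * Real.exp (-l) := by
            gcongr
            refine (one_sub_pow_le_exp h1 q).trans_eq ?_
            rw [hq]
            congr 1
            push_cast
            field_simp
        _ ≤ 1 / 2 := by
            rw [Real.exp_neg, ← div_eq_mul_inv, div_le_iff₀ (Real.exp_pos _), hs']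
            linarith
    · rw [hn]
      refine mul_choose_lt_quarter hk0 ((hkpow 2 (by norm_num)).trans' ?_)
      gcongr
      norm_num
    · rw [hs]
      exact pow_mul_one_sub_inv_pow_lt_quarter hk0 hn2k
    · refine pow_mul_one_sub_pow_sq_lt_quarter hk0 hs0 hn2k hd8 hm2 hn0
        (by exact_mod_cast hM1) (Real.exp_pos (x / 2)) ?_ ?_
      · calc ((16 * k : ℕ) : ℝ) ^ (2 * τ) ≤ Real.exp l ^ (2 * τ) := by gcongr
          _ = Real.exp (2 * τ * l) := by rw [← Real.exp_nat_mul]; push_cast; rfl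
          _ ≤ Real.exp (x / 2) := by
            apply Real.exp_le_exp.2
            rw [le_div_iff₀ (by positivity)] at hτ1
            linarith
      · calc 8192 * k * (s : ℝ) ^ 9 * Real.exp (x / 2)
            = 8192 * 10 ^ 18 * (k : ℝ) ^ 19 * Real.exp (x / 2) := by rw [hs']; ring
          _ ≤ 10 ^ 22 * (k : ℝ) ^ 19 * Real.exp (x / 2) := by gcongr; norm_num
          _ ≤ Real.exp (x / 2) * Real.exp (x / 2) := by gcongr
          _ ≤ n := hΔh ▸ hΔn
  have hd2' : (n : ℝ) * (τ + 1) ≤ 4 * (2 * (τ + 1) + 16 * k * l) * (d + 1) := by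
    have := hd2.le
    rw [hq] at this
    exact_mod_cast this
  have hkτ : (k : ℝ) ≤ 8 * l * (τ + 1) := by
    rw [div_le_iff₀ (by positivity)] at hτ2
    linarith
  have hden : 4 * (2 * ((τ : ℝ) + 1) + 16 * k * l) ≤ (τ + 1) * (520 * l ^ 2) := by
    have h1 : 16 * (k : ℝ) * l ≤ 16 * (8 * l * (τ + 1)) * l := by gcongr
    have h2 : (τ + 1 : ℝ) * 1 ≤ (τ + 1) * l ^ 2 := by
      gcongr
      exact one_le_pow₀ hl1'
    linarith
  have hnd : (n : ℝ) ≤ (d + 1) * (520 * l ^ 2) := by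
    have h1 : ((τ : ℝ) + 1) * n ≤ (τ + 1) * ((d + 1) * (520 * l ^ 2)) := by
      calc ((τ : ℝ) + 1) * n = n * (τ + 1) := by ring
        _ ≤ 4 * (2 * (τ + 1) + 16 * k * l) * (d + 1) := hd2'
        _ ≤ (τ + 1) * (520 * l ^ 2) * (d + 1) := by gcongr
        _ = _ := by ring
    exact le_of_mul_le_mul_left h1 (by positivity)
  have hdB : (d : ℝ) + 1 ≤ maxBoxicity Δ := by exact_mod_cast hlt
  calc Δ * x ≤ n := by rw [hn']; gcongr
    _ ≤ (d + 1) * (520 * l ^ 2) := hnd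
    _ ≤ maxBoxicity Δ * (520 * l ^ 2) := by gcongr
    _ = _ := by ring

/-- The lower bound in terms of `x = log Δ` and `L = log log Δ`. The power `19` of `log Δ` comes from
`8192 k s ^ 9` with `s = 100 k ^ 2`. -/
theorem le_maxBoxicity_mul (Δ : ℕ) {x L : ℝ} (hx : Real.log Δ = x) (hL : Real.log x = L)
    (hx1 : 1 ≤ x) (hL8 : 8 ≤ L) (hbig : 10 ^ 22 * (2 * x) ^ 19 ≤ Real.exp (x / 2))
    (hbdd : BddAbove {b : ℕ | ∃ (n : ℕ) (G : SimpleGraph (Fin n)) (_ : DecidableRel G.Adj),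
      G.maxDegree = Δ ∧ G.boxicity = b}) :
    Δ * x ≤ 4680 * L ^ 2 * maxBoxicity Δ := by
  have hx0 : 0 < x := by linarith
  have hxL : x = Real.exp L := by rw [← hL, Real.exp_log hx0]
  have hΔ0 : (0 : ℝ) < Δ := by
    rcases Nat.eq_zero_or_pos Δ with rfl | h
    · simp at hx; linarith
    · exact_mod_cast h
  have hΔx : (Δ : ℝ) = Real.exp x := by rw [← hx, Real.exp_log hΔ0]
  obtain ⟨k, hk⟩ : ∃ k, k = ⌈x⌉₊ := ⟨_, rfl⟩
  have hk1 : x ≤ k := hk ▸ Nat.le_ceil _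
  have hk2 : (k : ℝ) ≤ 2 * x := by
    have : (k : ℝ) ≤ x + 1 := hk ▸ (Nat.ceil_lt_add_one hx0.le).le
    linarith
  have hk1' : (1 : ℝ) ≤ k := by linarith
  obtain ⟨l, hl1, hl2⟩ := exists_nat_log_le_le hx1 hL hL8 hk1' hk2
  have hexpl : 200 * (k : ℝ) ^ 2 ≤ Real.exp l := by
    rwa [Real.log_le_iff_le_exp (by positivity)] at hl1
  have hl0 : (0 : ℝ) < l := lt_of_lt_of_le (Real.log_pos (by nlinarith)) hl1
  have h := le_maxBoxicity_mul_of_parameters hΔx hk1 hk2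
    (by exact_mod_cast (by linarith : (0 : ℝ) < k)) (by exact_mod_cast hl0)
    (le_trans (by gcongr) hbig) hexpl hbdd
  calc Δ * x ≤ 520 * l ^ 2 * maxBoxicity Δ := h
    _ ≤ 520 * (3 * L) ^ 2 * maxBoxicity Δ := by gcongr
    _ = _ := by ring

end LowerAsymptotics

/-! ### The maximum boxicity up to a factor `log ^ o(1)` -/

section MaxBoxicity

lemma tendsto_log_log : Tendsto (fun Δ : ℕ => Real.log (Real.log Δ)) atTop atTop :=
  Real.tendsto_log_atTop.comp (Real.tendsto_log_atTop.comp tendsto_natCast_atTop_atTop)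

lemma eventually_maxBoxicity_le : ∀ᶠ Δ : ℕ in atTop,
    BddAbove {b : ℕ | ∃ (n : ℕ) (G : SimpleGraph (Fin n)) (_ : DecidableRel G.Adj),
      G.maxDegree = Δ ∧ G.boxicity = b} ∧
    (maxBoxicity Δ : ℝ) ≤ 180 * (Δ : ℝ) * Real.log Δ *
      (2 * Real.exp 1) ^ √(Real.log (Real.log Δ)) * Real.log (Real.log Δ) := by
  filter_upwards [eventually_boxicity_le, tendsto_log_log.eventually_ge_atTop 0] with Δ h hL
  have h0 : 0 ≤ 180 * (Δ : ℝ) * Real.log Δ *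
      (2 * Real.exp 1) ^ √(Real.log (Real.log Δ)) * Real.log (Real.log Δ) := by
    have := Real.log_natCast_nonneg Δ
    positivity
  have hub : ⌊180 * (Δ : ℝ) * Real.log Δ *
      (2 * Real.exp 1) ^ √(Real.log (Real.log Δ)) * Real.log (Real.log Δ)⌋₊ ∈
      upperBounds {b : ℕ | ∃ (n : ℕ) (G : SimpleGraph (Fin n)) (_ : DecidableRel G.Adj),
        G.maxDegree = Δ ∧ G.boxicity = b} := by
    rintro b ⟨n, G, hdec, hG, rfl⟩
    exact Nat.le_floor (h (Fin n) G hG)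
  exact ⟨⟨_, hub⟩, (Nat.cast_le.2 (csSup_le' hub)).trans (Nat.floor_le h0)⟩

lemma eventually_le_maxBoxicity : ∀ᶠ Δ : ℕ in atTop,
    Δ * Real.log Δ ≤ 4680 * Real.log (Real.log Δ) ^ 2 * maxBoxicity Δ := by
  have ht : Tendsto (fun x : ℝ => Real.exp (x / 2) / (x / 2) ^ 19) atTop atTop :=
    (Real.tendsto_exp_div_pow_atTop 19).comp
      (tendsto_id.atTop_div_const (by norm_num : (0 : ℝ) < 2))
  have hlog : Tendsto (fun Δ : ℕ => Real.log Δ) atTop atTop :=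
    Real.tendsto_log_atTop.comp tendsto_natCast_atTop_atTop
  filter_upwards [eventually_maxBoxicity_le, tendsto_log_log.eventually_ge_atTop 8,
    hlog.eventually_ge_atTop 1, (ht.comp hlog).eventually_ge_atTop (10 ^ 22 * 4 ^ 19)]
    with Δ hb h8 h1 h
  refine le_maxBoxicity_mul Δ rfl rfl h1 h8 ?_ hb.1
  rw [Function.comp_apply, le_div_iff₀ (by positivity)] at h
  refine le_trans (le_of_eq ?_) h
  ring

/-- Both bounds on the logarithm of `bx(Δ) / Δ` are `log log Δ` up to a lower order term. -/
lemma tendsto_log_maxBoxicity_div :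
    Tendsto (fun Δ : ℕ => Real.log (maxBoxicity Δ / Δ) / Real.log (Real.log Δ) - 1)
      atTop (𝓝 0) := by
  have hlogdiv : Tendsto (fun L : ℝ => Real.log L / L) atTop (𝓝 0) :=
    Real.isLittleO_log_id_atTop.tendsto_div_nhds_zero
  have hsqrt : Tendsto (fun L : ℝ => √L / L) atTop (𝓝 0) := by
    have h : Tendsto (fun L : ℝ => (√L)⁻¹) atTop (𝓝 0) :=
      tendsto_inv_atTop_zero.comp Real.tendsto_sqrt_atTop
    refine h.congr fun L => ?_
    rw [Real.sqrt_div_self']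
    simp
  have hconst : ∀ c : ℝ, Tendsto (fun L : ℝ => c / L) atTop (𝓝 0) := fun c =>
    tendsto_const_nhds.div_atTop tendsto_id
  have hlo : Tendsto (fun L : ℝ => -(Real.log 4680 / L + 2 * (Real.log L / L))) atTop (𝓝 0) := by
    simpa using ((hconst (Real.log 4680)).add (hlogdiv.const_mul 2)).neg
  have hup : Tendsto (fun L : ℝ => Real.log 180 / L + Real.log (2 * Real.exp 1) * (√L / L) +
      Real.log L / L) atTop (𝓝 0) := by
    simpa using ((hconst (Real.log 180)).add (hsqrt.const_mul (Real.log (2 * Real.exp 1)))).add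
      hlogdiv
  refine tendsto_of_tendsto_of_tendsto_of_le_of_le' (hlo.comp tendsto_log_log)
    (hup.comp tendsto_log_log) ?_ ?_
  · filter_upwards [eventually_le_maxBoxicity, tendsto_log_log.eventually_ge_atTop 1,
      eventually_gt_atTop 1] with Δ h hL hΔ
    have hΔ0 : (0 : ℝ) < Δ := by exact_mod_cast (by omega : 0 < Δ)
    have hx : 0 < Real.log Δ := Real.log_pos (by exact_mod_cast hΔ)
    have hL0 : 0 < Real.log (Real.log Δ) := by linarith
    have h1 : Real.log Δ / (4680 * Real.log (Real.log Δ) ^ 2) ≤ maxBoxicity Δ / Δ := by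
      rw [div_le_div_iff₀ (by positivity) hΔ0]
      linarith
    have h2 := Real.log_le_log (by positivity) h1
    rw [Real.log_div hx.ne' (by positivity), Real.log_mul (by norm_num) (by positivity),
      Real.log_pow] at h2
    push_cast at h2
    simp only [Function.comp_apply]
    rw [le_sub_iff_add_le, le_div_iff₀ hL0]
    refine le_trans (le_of_eq ?_) h2
    field_simp
    ring
  · filter_upwards [eventually_maxBoxicity_le, eventually_le_maxBoxicity,
      tendsto_log_log.eventually_ge_atTop 1, eventually_gt_atTop 1] with Δ h h' hL hΔ
    have hΔ0 : (0 : ℝ) < Δ := by exact_mod_cast (by omega : 0 < Δ)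
    have hx : 0 < Real.log Δ := Real.log_pos (by exact_mod_cast hΔ)
    have hL0 : 0 < Real.log (Real.log Δ) := by linarith
    have hmb : (0 : ℝ) < maxBoxicity Δ :=
      pos_of_mul_pos_right (lt_of_lt_of_le (by positivity) h') (by positivity)
    have h1 : maxBoxicity Δ / Δ ≤ 180 * Real.log Δ *
        (2 * Real.exp 1) ^ √(Real.log (Real.log Δ)) * Real.log (Real.log Δ) := by
      rw [div_le_iff₀ hΔ0]
      refine h.2.trans (le_of_eq ?_)
      ring
    have h2 := Real.log_le_log (by positivity) h1
    rw [Real.log_mul (by positivity) hL0.ne', Real.log_mul (by positivity) (by positivity),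
      Real.log_mul (by norm_num) hx.ne', Real.log_rpow (by positivity)] at h2
    simp only [Function.comp_apply]
    rw [sub_le_iff_le_add, div_le_iff₀ hL0]
    refine h2.trans (le_of_eq ?_)
    field_simp
    ring

end MaxBoxicity

theorem theorem3p5 :
    (∃ ε : ℕ → ℝ, Tendsto ε atTop (𝓝 0) ∧
      ∀ᶠ Δ : ℕ in atTop, ∀ (V : Type*) [Fintype V] (G : SimpleGraph V) [DecidableRel G.Adj],
        G.maxDegree = Δ →
          (G.boxicity : ℝ) ≤ (180 + ε Δ) * (Δ : ℝ) * Real.log Δ *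
            (2 * Real.exp 1) ^ Real.sqrt (Real.log (Real.log Δ)) * Real.log (Real.log Δ)) ∧
    (∃ δ : ℕ → ℝ, Tendsto δ atTop (𝓝 0) ∧
      ∀ᶠ Δ : ℕ in atTop, (maxBoxicity Δ : ℝ) = (Δ : ℝ) * (Real.log Δ) ^ (1 + δ Δ)) := by
  refine ⟨⟨fun _ => 0, tendsto_const_nhds, ?_⟩, ⟨_, tendsto_log_maxBoxicity_div, ?_⟩⟩
  · simpa only [add_zero] using eventually_boxicity_le
  · filter_upwards [eventually_le_maxBoxicity, tendsto_log_log.eventually_ge_atTop 1,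
      eventually_gt_atTop 1] with Δ h hL hΔ
    have hΔ0 : (0 : ℝ) < Δ := by exact_mod_cast (by omega : 0 < Δ)
    have hx : 0 < Real.log Δ := Real.log_pos (by exact_mod_cast hΔ)
    have hL0 : 0 < Real.log (Real.log Δ) := by linarith
    have hmb : (0 : ℝ) < maxBoxicity Δ :=
      pos_of_mul_pos_right (lt_of_lt_of_le (by positivity) h) (by positivity)
    rw [add_sub_cancel, Real.rpow_def_of_pos hx, mul_div_cancel₀ _ hL0.ne',
      Real.exp_log (by positivity), mul_div_cancel₀ _ hΔ0.ne']
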